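/- Let $N\ge 0$ and $K\ge 1$ be integers. Let $C(U^*_{N,K})$ be the universal unital $C^*$-algebra with generators $u_{ij}$, $1\le i,j\le N$, subject to the relations that the matrix $u=(u_{ij})$ and its transpose $u^t$ are both unitary (that is, $uu^*=u^*u=1$ and $u^t\bar u=\bar u u^t=1$, where $\bar u=(u_{ij}^*)$) and that all $K$-fold products of generators commute: $$[u_{i_1j_1}\cdots u_{i_Kj_K},\,u_{k_1l_1}\cdots u_{k_Kl_K}]=0\quad\text{for all indices.}$$ Let the cyclic group $\mathbb Z_K=\langle\tau\rangle$ act on $U_N^K$ by cyclic permutation of the factors, $\tau(z_0,\ldots,z_{K-1})=(z_{K-1},z_0,\ldots,z_{K-2})$, and on $C(U_N^K)$ by $(\tau f)(z)=f(\tau^{-1}z)$, and let $C(U_N^K)\rtimes\mathbb Z_K$ be the crossed product $C^*$-algebra, with product $(a\otimes g)(b\otimes h)=a\,g(b)\otimes gh$. Let $a_{ij,0}\in C(U_N^K)$ be the function $(z_0,\ldots,z_{K-1})\mapsto (z_0)_{ij}$. Then there is an injective morphism of unital $C^*$-algebras $$\pi: C(U^*_{N,K})\longrightarrow C(U_N^K)\rtimes\mathbb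 Z_K,\qquad \pi(u_{ij})=a_{ij,0}\otimes\tau .$$ -/

import Mathlib

noncomputable section

/-- The free unital complex `*`-algebra on the set `X`: noncommutative polynomials in the
letters `(x, false)`, which stand for `x`, and `(x, true)`, which stand for `x⋆`. -/
def FreeStarAlgebra (X : Type*) : Type _ := FreeAlgebra ℂ (X × Bool)

namespace FreeStarAlgebra

variable {X : Type*}

instance : Ring (FreeStarAlgebra X) := inferInstanceAs (Ring (FreeAlgebra ℂ (X × Bool)))

instance : Algebra ℂ (FreeStarAlgebra X) :=
  inferInstanceAs (Algebra ℂ (FreeAlgebra ℂ (X × Bool)))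

/-- The letters of the free `*`-algebra. -/
def letter (y : X × Bool) : FreeStarAlgebra X := FreeAlgebra.ι ℂ y

/-- The free generator `x`. -/
def gen (x : X) : FreeStarAlgebra X := letter (x, false)

theorem induction {P : FreeStarAlgebra X → Prop}
    (scalar : ∀ c : ℂ, P (algebraMap ℂ _ c)) (let_ : ∀ y, P (letter y))
    (mul : ∀ a b, P a → P b → P (a * b)) (add : ∀ a b, P a → P b → P (a + b))
    (a : FreeStarAlgebra X) : P a :=
  FreeAlgebra.induction ℂ (X × Bool) (motive := P) scalar let_ mul add a

/-- The conjugate-linear antimultiplicative map that exchanges `x` and `x⋆`. -/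
def starHom (X : Type*) : FreeStarAlgebra X →+* (FreeStarAlgebra X)ᵐᵒᵖ :=
  letI : Algebra ℂ (FreeStarAlgebra X)ᵐᵒᵖ :=
    ((algebraMap ℂ (FreeStarAlgebra X)ᵐᵒᵖ).comp (starRingEnd ℂ)).toAlgebra'
      (fun c x => Algebra.commutes (R := ℂ) (starRingEnd ℂ c) x)
  ((FreeAlgebra.lift ℂ (fun y : X × Bool => MulOpposite.op (letter (y.1, !y.2))) :
    FreeAlgebra ℂ (X × Bool) →ₐ[ℂ] (FreeStarAlgebra X)ᵐᵒᵖ) :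
      FreeAlgebra ℂ (X × Bool) →+* (FreeStarAlgebra X)ᵐᵒᵖ)

theorem starHom_letter (y : X × Bool) :
    starHom X (letter y) = MulOpposite.op (letter (y.1, !y.2)) := by
  let : Algebra ℂ (FreeStarAlgebra X)ᵐᵒᵖ :=
    ((algebraMap ℂ (FreeStarAlgebra X)ᵐᵒᵖ).comp (starRingEnd ℂ)).toAlgebra'
      (fun c x => Algebra.commutes (R := ℂ) (starRingEnd ℂ c) x)
  exact FreeAlgebra.lift_ι_apply (R := ℂ) _ y

theorem starHom_algebraMap (c : ℂ) :
    starHom X (algebraMap ℂ _ c) = MulOpposite.op (algebraMap ℂ _ (starRingEnd ℂ c)) := by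
  let : Algebra ℂ (FreeStarAlgebra X)ᵐᵒᵖ :=
    ((algebraMap ℂ (FreeStarAlgebra X)ᵐᵒᵖ).comp (starRingEnd ℂ)).toAlgebra'
      (fun c x => Algebra.commutes (R := ℂ) (starRingEnd ℂ c) x)
  exact AlgHom.commutes (FreeAlgebra.lift ℂ (fun y : X × Bool =>
    MulOpposite.op (letter (y.1, !y.2))) :
    FreeAlgebra ℂ (X × Bool) →ₐ[ℂ] (FreeStarAlgebra X)ᵐᵒᵖ) c

theorem starHom_starHom (a : FreeStarAlgebra X) :
    (starHom X (starHom X a).unop).unop = a := by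
  induction a using induction with
  | scalar c => simp [starHom_algebraMap]
  | let_ y => simp [starHom_letter]
  | mul a b ha hb => simp [ha, hb]
  | add a b ha hb => simp [ha, hb]

instance : StarRing (FreeStarAlgebra X) where
  star a := (starHom X a).unop
  star_involutive := starHom_starHom
  star_mul a b := by simp
  star_add a b := by simp

theorem star_def (a : FreeStarAlgebra X) : star a = (starHom X a).unop := rfl

theorem star_letter (y : X × Bool) : star (letter y) = letter (y.1, !y.2) := by
  simp [star_def, starHom_letter]

instance : StarModule ℂ (FreeStarAlgebra X) where
  star_smul c a := by
    simp [Algebra.smul_def, star_def, starHom_algebraMap, Algebra.commutes]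

end FreeStarAlgebra

/-- A `C⋆`-seminorm on a unital complex `*`-algebra. -/
structure CStarSeminorm (𝒜 : Type*) [Ring 𝒜] [StarRing 𝒜] [Algebra ℂ 𝒜]
    extends Seminorm ℂ 𝒜 where
  mul_le' : ∀ a b, toFun (a * b) ≤ toFun a * toFun b
  star_mul_self' : ∀ a, toFun (star a * a) = toFun a * toFun a

namespace CStarSeminorm

variable {𝒜 : Type*} [Ring 𝒜] [StarRing 𝒜] [Algebra ℂ 𝒜]

instance : CoeFun (CStarSeminorm 𝒜) (fun _ => 𝒜 → ℝ) := ⟨fun p => p.toSeminorm⟩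

theorem star_le (p : CStarSeminorm 𝒜) (a : 𝒜) : p (star a) ≤ p a := by
  have h : p (star (star a) * star a) = p (star a) * p (star a) := p.star_mul_self' (star a)
  rw [star_star] at h
  have h2 : p (a * star a) ≤ p a * p (star a) := p.mul_le' a (star a)
  have h0 : 0 ≤ p (star a) := apply_nonneg p.toSeminorm _
  have h1 : 0 ≤ p a := apply_nonneg p.toSeminorm _
  by_contra hc
  push Not at hc
  nlinarith

theorem star_eq (p : CStarSeminorm 𝒜) (a : 𝒜) : p (star a) = p a :=
  le_antisymm (p.star_le a) (by simpa using p.star_le (star a))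

/-- A copy of the `*`-algebra `𝒜`, with the seminorm `p` as its (semi)norm. -/
def Carrier (_p : CStarSeminorm 𝒜) : Type _ := 𝒜

instance (p : CStarSeminorm 𝒜) : Ring p.Carrier := inferInstanceAs (Ring 𝒜)
instance (p : CStarSeminorm 𝒜) : StarRing p.Carrier := inferInstanceAs (StarRing 𝒜)
instance (p : CStarSeminorm 𝒜) : Algebra ℂ p.Carrier := inferInstanceAs (Algebra ℂ 𝒜)
instance (p : CStarSeminorm 𝒜) [StarModule ℂ 𝒜] : StarModule ℂ p.Carrier :=
  inferInstanceAs (StarModule ℂ 𝒜)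

instance (p : CStarSeminorm 𝒜) : SeminormedRing p.Carrier where
  __ := (inferInstance : Ring p.Carrier)
  __ := p.toAddGroupSeminorm.toSeminormedAddCommGroup
  norm_mul_le := p.mul_le'

theorem norm_carrier (p : CStarSeminorm 𝒜) (a : p.Carrier) : ‖a‖ = p.toSeminorm a := rfl

instance (p : CStarSeminorm 𝒜) : NormedAlgebra ℂ p.Carrier where
  norm_smul_le c a := (map_smul_eq_mul p.toSeminorm c a).le

instance (p : CStarSeminorm 𝒜) : NormedStarGroup p.Carrier where
  norm_star_le a := p.star_le a

/-- The completion of the `*`-algebra `𝒜` with respect to the `C⋆`-seminorm `p` (elements of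
seminorm `0` being identified with `0`). -/
def Completion (p : CStarSeminorm 𝒜) : Type _ := UniformSpace.Completion p.Carrier

/-- The canonical map from the `*`-algebra to its completion. -/
def of (p : CStarSeminorm 𝒜) (a : 𝒜) : p.Completion :=
  ((show p.Carrier from a : p.Carrier) : UniformSpace.Completion p.Carrier)

namespace Completion

open UniformSpace (Completion)
open UniformSpace.Completion

variable (p : CStarSeminorm 𝒜)

instance : NormedRing p.Completion :=
  inferInstanceAs (NormedRing (UniformSpace.Completion p.Carrier))

instance : CompleteSpace p.Completion :=
  inferInstanceAs (CompleteSpace (UniformSpace.Completion p.Carrier))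

instance : NormedAlgebra ℂ p.Completion where
  __ := (inferInstanceAs (Algebra ℂ (UniformSpace.Completion p.Carrier)) :
    Algebra ℂ p.Completion)
  norm_smul_le := norm_smul_le (α := ℂ) (β := UniformSpace.Completion p.Carrier)

theorem isometry_star_carrier : Isometry (star : p.Carrier → p.Carrier) := star_isometry

/-- The involution, extended by continuity. -/
instance : Star p.Completion := ⟨UniformSpace.Completion.map (star : p.Carrier → p.Carrier)⟩

theorem star_of (a : 𝒜) : star (p.of a) = p.of (star a) :=
  UniformSpace.Completion.map_coe (isometry_star_carrier p).uniformContinuous _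

theorem of_mul (a b : 𝒜) : p.of (a * b) = p.of a * p.of b :=
  UniformSpace.Completion.coe_mul (α := p.Carrier) a b

theorem of_add (a b : 𝒜) : p.of (a + b) = p.of a + p.of b :=
  UniformSpace.Completion.coe_add (α := p.Carrier) a b

theorem of_smul (c : ℂ) (a : 𝒜) : p.of (c • a) = c • p.of a :=
  UniformSpace.Completion.coe_smul (X := p.Carrier) c a

theorem of_one : p.of 1 = 1 := UniformSpace.Completion.coe_one p.Carrier

theorem of_zero : p.of 0 = 0 := UniformSpace.Completion.coe_zero (α := p.Carrier)

theorem norm_of (a : 𝒜) : ‖p.of a‖ = p a :=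
  UniformSpace.Completion.norm_coe (E := p.Carrier) a

theorem denseRange_of : DenseRange p.of :=
  UniformSpace.Completion.denseRange_coe (α := p.Carrier)

theorem continuous_star : Continuous (star : p.Completion → p.Completion) :=
  UniformSpace.Completion.continuous_map

instance : StarRing p.Completion where
  star_involutive a := (denseRange_of p).induction_on (p := fun a => star (star a) = a) a
    (isClosed_eq ((continuous_star p).comp (continuous_star p)) continuous_id)
    (fun a => by simp [star_of])
  star_mul a b := (denseRange_of p).induction_on₂
    (p := fun a b => star (a * b) = star b * star a)
    (isClosed_eq ((continuous_star p).comp continuous_mul)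
      (((continuous_star p).comp continuous_snd).mul ((continuous_star p).comp continuous_fst)))
    (fun a b => by simp only [star_of, ← of_mul, star_mul]) a b
  star_add a b := (denseRange_of p).induction_on₂
    (p := fun a b => star (a + b) = star a + star b)
    (isClosed_eq ((continuous_star p).comp continuous_add)
      (((continuous_star p).comp continuous_fst).add ((continuous_star p).comp continuous_snd)))
    (fun a b => by simp only [star_of, ← of_add, star_add]) a b

instance : CStarRing p.Completion where
  norm_mul_self_le a := (denseRange_of p).induction_on
    (p := fun a => ‖a‖ * ‖a‖ ≤ ‖star a * a‖) a
    (isClosed_le (continuous_norm.mul continuous_norm)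
      (((continuous_star p).mul continuous_id).norm))
    (fun a => by
      rw [star_of, ← of_mul, norm_of, norm_of]
      exact (p.star_mul_self' a).ge)

variable [StarModule ℂ 𝒜]

instance : StarModule ℂ p.Completion where
  star_smul c a := (denseRange_of p).induction_on (p := fun a => star (c • a) = star c • star a) a
    (isClosed_eq ((continuous_star p).comp (continuous_const_smul c))
      ((continuous_const_smul (star c)).comp (continuous_star p)))
    (fun a => by simp only [star_of, ← of_smul, star_smul])

instance : CStarAlgebra p.Completion where

end Completion

end CStarSeminorm

namespace CStarSeminorm

variable {𝒜 : Type*} [Ring 𝒜] [StarRing 𝒜] [Algebra ℂ 𝒜]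

theorem nonneg (p : CStarSeminorm 𝒜) (a : 𝒜) : 0 ≤ p a := apply_nonneg p.toSeminorm a

theorem one_le (p : CStarSeminorm 𝒜) : p 1 ≤ 1 := by
  have h : p (star 1 * 1) = p 1 * p 1 := p.star_mul_self' 1
  rw [star_one, one_mul] at h
  nlinarith [p.nonneg 1, sq_nonneg (p 1 - 1)]

/-- The `C⋆`-seminorms for which the relations `r = 0`, `r ∈ R`, hold. -/
def Compatible (R : Set 𝒜) : Type _ := {p : CStarSeminorm 𝒜 // ∀ r ∈ R, p r = 0}

instance (R : Set 𝒜) : Nonempty (Compatible R) :=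
  ⟨{ toSeminorm := 0
     mul_le' := fun _ _ => (mul_zero (0 : ℝ)).ge
     star_mul_self' := fun _ => (mul_zero (0 : ℝ)).symm }, fun _ _ => rfl⟩

end CStarSeminorm

/-- The relations `R` are bounded: the values at any given element of the `C⋆`-seminorms
compatible with `R` are bounded, so that there is a largest such seminorm. -/
class BoundedRelations {𝒜 : Type*} [Ring 𝒜] [StarRing 𝒜] [Algebra ℂ 𝒜] (R : Set 𝒜) : Prop where
  bddAbove : ∀ a : 𝒜, BddAbove (Set.range fun p : CStarSeminorm.Compatible R => p.1 a)

section Universal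

variable {𝒜 : Type*} [Ring 𝒜] [StarRing 𝒜] [Algebra ℂ 𝒜]

open CStarSeminorm in
/-- The largest `C⋆`-seminorm compatible with the relations `R`. -/
def maxCStarSeminorm (R : Set 𝒜) [BoundedRelations R] : CStarSeminorm 𝒜 where
  toFun a := ⨆ p : Compatible R, p.1 a
  map_zero' := by simp
  add_le' a b := ciSup_le fun p => (map_add_le_add p.1.toSeminorm a b).trans
    (add_le_add (le_ciSup (BoundedRelations.bddAbove (R := R) a) p)
      (le_ciSup (BoundedRelations.bddAbove (R := R) b) p))
  neg' a := by simp
  smul' c a := by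
    rw [Real.mul_iSup_of_nonneg (norm_nonneg c)]
    exact iSup_congr fun p => map_smul_eq_mul p.1.toSeminorm c a
  mul_le' a b := ciSup_le fun p => (p.1.mul_le' a b).trans
    (mul_le_mul (le_ciSup (BoundedRelations.bddAbove (R := R) a) p)
      (le_ciSup (BoundedRelations.bddAbove (R := R) b) p) (p.1.nonneg b)
      (Real.iSup_nonneg fun q => q.1.nonneg a))
  star_mul_self' a := by
    have h (p : Compatible R) : p.1 (star a * a) = p.1 a * p.1 a := p.1.star_mul_self' a
    have h0 : 0 ≤ ⨆ p : Compatible R, p.1 a := Real.iSup_nonneg fun q => q.1.nonneg a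
    have hb := BoundedRelations.bddAbove (R := R) a
    refine le_antisymm (ciSup_le fun p => ?_) ?_
    · exact (h p).trans_le (mul_le_mul (le_ciSup hb p) (le_ciSup hb p) (p.1.nonneg a) h0)
    · have h1 : ⨆ p : Compatible R, p.1 a ≤ √(⨆ p : Compatible R, p.1 (star a * a)) :=
        ciSup_le fun p => Real.le_sqrt_of_sq_le (by
          rw [sq, ← h p]
          exact le_ciSup (BoundedRelations.bddAbove (R := R) (star a * a)) p)
      calc _ ≤ √(⨆ p : Compatible R, p.1 (star a * a)) * √(⨆ p : Compatible R, p.1 (star a * a)) :=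
            mul_le_mul h1 h1 h0 (Real.sqrt_nonneg _)
        _ = _ := Real.mul_self_sqrt (Real.iSup_nonneg fun q => q.1.nonneg _)

/-- The universal (enveloping) `C⋆`-algebra of the `*`-algebra `𝒜` subject to the relations
`r = 0`, `r ∈ R`: the completion of `𝒜` for the largest `C⋆`-seminorm that vanishes on `R`. -/
abbrev UniversalCStarAlgebra (R : Set 𝒜) [BoundedRelations R] : Type _ :=
  (maxCStarSeminorm R).Completion

end Universal

theorem BoundedRelations.of_gen {X : Type*} (R : Set (FreeStarAlgebra X))
    (h : ∀ x, BddAbove (Set.range fun p : CStarSeminorm.Compatible R =>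
      p.1 (FreeStarAlgebra.gen x))) : BoundedRelations R where
  bddAbove a := by
    induction a using FreeStarAlgebra.induction with
    | scalar c =>
      refine ⟨‖c‖, ?_⟩
      rintro _ ⟨p, rfl⟩
      have : p.1 (c • (1 : FreeStarAlgebra X)) = ‖c‖ * p.1 1 := map_smul_eq_mul p.1.toSeminorm c 1
      change p.1 _ ≤ _
      rw [Algebra.algebraMap_eq_smul_one, this]
      exact mul_le_of_le_one_right (norm_nonneg c) p.1.one_le
    | let_ y =>
      obtain ⟨C, hC⟩ := h y.1
      refine ⟨C, ?_⟩
      rintro _ ⟨p, rfl⟩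
      have hp : p.1 (FreeStarAlgebra.gen y.1) ≤ C := hC ⟨p, rfl⟩
      obtain ⟨x, b⟩ := y
      cases b with
      | false => exact hp
      | true =>
        have : FreeStarAlgebra.letter (x, true) = star (FreeStarAlgebra.gen x) := by
          simp [FreeStarAlgebra.gen, FreeStarAlgebra.star_letter]
        change p.1 _ ≤ _
        rw [this, p.1.star_eq]
        exact hp
    | mul a b ha hb =>
      obtain ⟨C, hC⟩ := ha
      obtain ⟨D, hD⟩ := hb
      refine ⟨C * D, ?_⟩
      rintro _ ⟨p, rfl⟩
      have h1 : p.1 a ≤ C := hC ⟨p, rfl⟩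
      have h2 : p.1 b ≤ D := hD ⟨p, rfl⟩
      exact (p.1.mul_le' a b).trans
        (mul_le_mul h1 h2 (p.1.nonneg b) ((p.1.nonneg a).trans h1))
    | add a b ha hb =>
      obtain ⟨C, hC⟩ := ha
      obtain ⟨D, hD⟩ := hb
      refine ⟨C + D, ?_⟩
      rintro _ ⟨p, rfl⟩
      exact (map_add_le_add p.1.toSeminorm a b).trans (add_le_add (hC ⟨p, rfl⟩) (hD ⟨p, rfl⟩))

section HalfLiberated

open FreeStarAlgebra Matrix

/-- The matrix `(u i j)` of free generators. -/
def freeMatrix (N : ℕ) : Matrix (Fin N) (Fin N) (FreeStarAlgebra (Fin N × Fin N)) :=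
  Matrix.of fun i j => gen (i, j)

/-- The relations of `C(U_N⁺)`: both `u` and its transpose `uᵀ` are unitary, that is,
`u uᴴ = uᴴ u = 1` and `uᵀ ū = ū uᵀ = 1`, where `ū = (u i j⋆)`. -/
def biunitaryRelations (N : ℕ) : Set (FreeStarAlgebra (Fin N × Fin N)) :=
  {r | ∃ i j, r = (freeMatrix N * (freeMatrix N)ᴴ - 1) i j ∨
    r = ((freeMatrix N)ᴴ * freeMatrix N - 1) i j ∨
    r = ((freeMatrix N)ᵀ * (freeMatrix N).map star - 1) i j ∨
    r = ((freeMatrix N).map star * (freeMatrix N)ᵀ - 1) i j}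

/-- The product `u (i 0) (j 0) * ⋯ * u (i (K-1)) (j (K-1))`. -/
def freeProduct {N K : ℕ} (i j : Fin K → Fin N) : FreeStarAlgebra (Fin N × Fin N) :=
  (List.ofFn fun s => freeMatrix N (i s) (j s)).prod

/-- The relations saying that all `K`-fold products of the `u i j` commute with each other. -/
def commutationRelations (N K : ℕ) : Set (FreeStarAlgebra (Fin N × Fin N)) :=
  {r | ∃ i j k l : Fin K → Fin N,
    r = freeProduct i j * freeProduct k l - freeProduct k l * freeProduct i j}

/-- The relations of `C(U_{N,K}^*)`. -/
def halfLiberatedRelations (N K : ℕ) : Set (FreeStarAlgebra (Fin N × Fin N)) :=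
  biunitaryRelations N ∪ commutationRelations N K

instance (N K : ℕ) : BoundedRelations (halfLiberatedRelations N K) :=
  BoundedRelations.of_gen _ fun x => by
    refine ⟨1, ?_⟩
    rintro _ ⟨p, rfl⟩
    obtain ⟨i, j⟩ := x
    change p.1 (gen (i, j)) ≤ 1
    let : PartialOrder p.1.Completion := CStarAlgebra.spectralOrder _
    have : StarOrderedRing p.1.Completion := CStarAlgebra.spectralOrderedRing _
    let q : FreeStarAlgebra (Fin N × Fin N) →+ p.1.Completion :=
      { toFun := p.1.of
        map_zero' := CStarSeminorm.Completion.of_zero p.1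
        map_add' := CStarSeminorm.Completion.of_add p.1 }
    have hq (a : FreeStarAlgebra (Fin N × Fin N)) : q (a * star a) = q a * star (q a) := by
      change p.1.of _ = p.1.of _ * star (p.1.of _)
      rw [CStarSeminorm.Completion.of_mul, CStarSeminorm.Completion.star_of]
    have hr := p.2 ((freeMatrix N * (freeMatrix N)ᴴ - 1) i i) (Or.inl ⟨i, i, Or.inl rfl⟩)
    rw [← CStarSeminorm.Completion.norm_of, norm_eq_zero] at hr
    have hsum : ∑ k, q (gen (i, k)) * star (q (gen (i, k))) = 1 := by
      have h1 : q ((freeMatrix N * (freeMatrix N)ᴴ - 1) i i) = 0 := hr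
      rw [Matrix.sub_apply, Matrix.mul_apply, map_sub, map_sum, sub_eq_zero, Matrix.one_apply_eq,
        show q 1 = 1 from CStarSeminorm.Completion.of_one p.1] at h1
      rw [← h1]
      exact Finset.sum_congr rfl fun k _ => (hq _).symm
    have hle : q (gen (i, j)) * star (q (gen (i, j))) ≤ 1 := by
      rw [← hsum]
      exact Finset.single_le_sum (f := fun k => q (gen (i, k)) * star (q (gen (i, k))))
        (fun k _ => mul_star_self_nonneg _) (Finset.mem_univ j)
    have hn := CStarAlgebra.norm_le_norm_of_nonneg_of_le (mul_star_self_nonneg _) hle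
    rw [CStarRing.norm_self_mul_star] at hn
    have h1 : ‖(1 : p.1.Completion)‖ ≤ 1 := by
      rw [← CStarSeminorm.Completion.of_one p.1, CStarSeminorm.Completion.norm_of]
      exact p.1.one_le
    have h2 : ‖q (gen (i, j))‖ = p.1 (gen (i, j)) := CStarSeminorm.Completion.norm_of p.1 _
    rw [h2] at hn
    nlinarith [p.1.nonneg (gen (i, j))]

/-- The `C⋆`-algebra `C(U_{N,K}^*)` of the `K`-half-liberated unitary quantum group. -/
abbrev HalfLiberatedUnitary (N K : ℕ) : Type :=
  UniversalCStarAlgebra (halfLiberatedRelations N K)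

/-- The standard generators `u i j` of `C(U_{N,K}^*)`. -/
def HalfLiberatedUnitary.u {N K : ℕ} (i j : Fin N) : HalfLiberatedUnitary N K :=
  (maxCStarSeminorm (halfLiberatedRelations N K)).of (gen (i, j))

end HalfLiberated

/-- The crossed product `A ⋊ G` of a unital `C⋆`-algebra `A` by an action `α` of a finite
group `G`. Its elements are the formal sums `∑ g, a g ⊗ g`, given by their coefficients
`a : G → A`; no completion is needed since `G` is finite. -/
def CrossedProduct {A G : Type*} [CStarAlgebra A] [Group G] (_α : G →* (A ≃⋆ₐ[ℂ] A)) : Type _ :=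
  G → A

namespace CrossedProduct

set_option linter.unusedSectionVars false

variable {A G : Type*} [CStarAlgebra A] [Group G] (α : G →* (A ≃⋆ₐ[ℂ] A))

instance : AddCommGroup (CrossedProduct α) := inferInstanceAs (AddCommGroup (G → A))

instance : Module ℂ (CrossedProduct α) := inferInstanceAs (Module ℂ (G → A))

theorem add_apply (a b : CrossedProduct α) (g : G) : (a + b) g = a g + b g := rfl

theorem smul_apply (c : ℂ) (a : CrossedProduct α) (g : G) : (c • a) g = c • a g := rfl

variable [DecidableEq G]

/-- The element `a ⊗ g` of the crossed product. -/
def single (g : G) (a : A) : CrossedProduct α := fun h => if h = g then a else 0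

instance : One (CrossedProduct α) := ⟨single α 1 1⟩

/-- The involution, `(a ⊗ g)⋆ = α_{g⁻¹}(a⋆) ⊗ g⁻¹`. -/
instance : Star (CrossedProduct α) := ⟨fun a g => α g (star (a g⁻¹))⟩

variable [Fintype G]

/-- The product, `(a ⊗ g)(b ⊗ h) = a α_g(b) ⊗ gh`. -/
instance : Mul (CrossedProduct α) := ⟨fun a b g => ∑ h, a h * α h (b (h⁻¹ * g))⟩

theorem mul_apply (a b : CrossedProduct α) (g : G) :
    (a * b) g = ∑ h, a h * α h (b (h⁻¹ * g)) := rfl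

theorem star_apply (a : CrossedProduct α) (g : G) : (star a) g = α g (star (a g⁻¹)) := rfl

theorem one_apply (g : G) : (1 : CrossedProduct α) g = if g = 1 then 1 else 0 := rfl

/-- The left regular representation of the crossed product, by matrices over `A`:
`a ⊗ 1` acts as the diagonal matrix with entries `α_{g⁻¹}(a)`, and `1 ⊗ g` acts as the
permutation matrix of left translation by `g`. -/
def regular : CrossedProduct α →+ CStarMatrix G G A where
  toFun a := CStarMatrix.ofMatrix fun k h => α k⁻¹ (a (k * h⁻¹))
  map_zero' := by
    ext k h
    exact map_zero (α k⁻¹)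
  map_add' a b := by
    ext k h
    exact map_add (α k⁻¹) _ _

theorem regular_apply (a : CrossedProduct α) (k h : G) :
    regular α a k h = α k⁻¹ (a (k * h⁻¹)) := rfl

theorem regular_injective : Function.Injective (regular α) := by
  intro a b hab
  funext g
  have h := congrArg (fun M : CStarMatrix G G A => M 1 g⁻¹) hab
  simpa [regular_apply] using h

theorem regular_mul (a b : CrossedProduct α) :
    regular α (a * b) = regular α a * regular α b := by
  ext k h
  rw [CStarMatrix.mul_apply, regular_apply, mul_apply, map_sum]
  refine Fintype.sum_equiv ((Equiv.inv G).trans (Equiv.mulRight k)) _ _ fun g => ?_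
  have h1 : α k⁻¹ (α g (b (g⁻¹ * (k * h⁻¹)))) = α (k⁻¹ * g) (b (g⁻¹ * (k * h⁻¹))) := by
    rw [map_mul]
    rfl
  rw [map_mul, h1]
  simp [regular_apply, mul_assoc]

theorem regular_one : regular α 1 = 1 := by
  ext k h
  rw [regular_apply, one_apply, CStarMatrix.one_apply]
  by_cases hkh : k = h
  · simp [hkh]
  · have : k * h⁻¹ ≠ 1 := fun hc => hkh (mul_inv_eq_one.mp hc)
    simp [hkh, this]

theorem regular_star (a : CrossedProduct α) : regular α (star a) = star (regular α a) := by
  ext k h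
  rw [CStarMatrix.star_apply, regular_apply, regular_apply, star_apply, ← map_star]
  have h1 (x : A) : α k⁻¹ (α (k * h⁻¹) x) = α (k⁻¹ * (k * h⁻¹)) x := by
    rw [map_mul α k⁻¹]
    rfl
  rw [h1]
  simp

theorem regular_smul (c : ℂ) (a : CrossedProduct α) : regular α (c • a) = c • regular α a := by
  ext k h
  exact map_smul (α k⁻¹) c _

instance : Ring (CrossedProduct α) where
  __ := (inferInstance : AddCommGroup (CrossedProduct α))
  left_distrib a b c := regular_injective α (by simp only [regular_mul, map_add, mul_add])
  right_distrib a b c := regular_injective α (by simp only [regular_mul, map_add, add_mul])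
  zero_mul a := regular_injective α (by simp only [regular_mul, map_zero, zero_mul])
  mul_zero a := regular_injective α (by simp only [regular_mul, map_zero, mul_zero])
  mul_assoc a b c := regular_injective α (by simp only [regular_mul, mul_assoc])
  one_mul a := regular_injective α (by simp only [regular_mul, regular_one, one_mul])
  mul_one a := regular_injective α (by simp only [regular_mul, regular_one, mul_one])

instance : Algebra ℂ (CrossedProduct α) :=
  Algebra.ofModule
    (fun c a b => regular_injective α (by simp only [regular_mul, regular_smul, smul_mul_assoc]))
    (fun c a b => regular_injective α (by simp only [regular_mul, regular_smul, mul_smul_comm]))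

instance : StarRing (CrossedProduct α) where
  star_involutive a := regular_injective α (by simp only [regular_star, star_star])
  star_mul a b := regular_injective α (by simp only [regular_star, regular_mul, star_mul])
  star_add a b := regular_injective α (by simp only [regular_star, map_add, star_add])

instance : StarModule ℂ (CrossedProduct α) where
  star_smul c a := regular_injective α (by simp only [regular_star, regular_smul, star_smul])

/-- The regular representation as a ring homomorphism. -/
def regularHom : CrossedProduct α →+* CStarMatrix G G A where
  __ := regular α
  map_one' := regular_one α
  map_mul' := regular_mul α

/-- The norm is the operator norm in the (faithful) regular representation on `A ⊗ ℓ²(G)`. -/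
instance : NormedRing (CrossedProduct α) :=
  letI : PartialOrder A := CStarAlgebra.spectralOrder A
  haveI : StarOrderedRing A := CStarAlgebra.spectralOrderedRing A
  NormedRing.induced (CrossedProduct α) (CStarMatrix G G A) (regularHom α) (regular_injective α)

theorem norm_def [PartialOrder A] [StarOrderedRing A] (a : CrossedProduct α) :
    ‖a‖ = ‖regular α a‖ := by
  have h : ‹PartialOrder A› = CStarAlgebra.spectralOrder A := by
    ext x y
    rw [StarOrderedRing.le_iff, (CStarAlgebra.spectralOrderedRing A).le_iff]
  subst h
  rfl

instance : NormedAlgebra ℂ (CrossedProduct α) where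
  norm_smul_le c a := by
    let : PartialOrder A := CStarAlgebra.spectralOrder A
    have : StarOrderedRing A := CStarAlgebra.spectralOrderedRing A
    rw [norm_def, norm_def, regular_smul]
    exact norm_smul_le c _

instance : CStarRing (CrossedProduct α) where
  norm_mul_self_le a := by
    let : PartialOrder A := CStarAlgebra.spectralOrder A
    have : StarOrderedRing A := CStarAlgebra.spectralOrderedRing A
    rw [norm_def, norm_def, regular_mul, regular_star, CStarRing.norm_star_mul_self]

instance : CompleteSpace (CrossedProduct α) := by
  let : PartialOrder A := CStarAlgebra.spectralOrder A
  have : StarOrderedRing A := CStarAlgebra.spectralOrderedRing A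
  have hiso : Isometry (regular α) :=
    AddMonoidHomClass.isometry_of_norm (regular α) fun a => (norm_def α a).symm
  have hα (g : G) : Continuous (α g) := (StarAlgEquiv.isometry (α g)).continuous
  have hent (k h : G) : Continuous fun M : CStarMatrix G G A => M k h :=
    (continuous_apply h).comp (continuous_apply k)
  have hrange : Set.range (regular α) =
      ⋂ k, ⋂ h, {M : CStarMatrix G G A | M k h = α k⁻¹ (M 1 (h * k⁻¹))} := by
    ext M
    simp only [Set.mem_range, Set.mem_iInter, Set.mem_ofPred_eq]
    constructor
    · rintro ⟨a, rfl⟩ k h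
      simp [regular_apply]
    · intro hM
      let a : CrossedProduct α := fun g => M 1 g⁻¹
      refine ⟨a, ?_⟩
      ext k h
      rw [hM k h, regular_apply]
      change α k⁻¹ (M 1 (k * h⁻¹)⁻¹) = _
      rw [mul_inv_rev, inv_inv]
  have hclosed : IsClosed (Set.range (regular α)) := by
    rw [hrange]
    exact isClosed_iInter fun k => isClosed_iInter fun h =>
      isClosed_eq (hent k h) ((hα _).comp (hent _ _))
  exact (completeSpace_iff_isComplete_range hiso.isUniformInducing).mpr hclosed.isComplete

instance : CStarAlgebra (CrossedProduct α) where

end CrossedProduct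

section CyclicAction

instance (N : ℕ) : CompactSpace (Matrix.unitaryGroup (Fin N) ℂ) := by
  have hclosed : IsClosed (Matrix.unitaryGroup (Fin N) ℂ : Set (Matrix (Fin N) (Fin N) ℂ)) := by
    have h : (Matrix.unitaryGroup (Fin N) ℂ : Set (Matrix (Fin N) (Fin N) ℂ)) =
        {M | M * star M = 1} := by
      ext M
      exact Matrix.mem_unitaryGroup_iff
    rw [h]
    exact isClosed_eq (continuous_id.matrix_mul continuous_id.matrix_conjTranspose)
      continuous_const
  have hcompact : IsCompact
      (Set.univ.pi fun _ : Fin N => Set.univ.pi fun _ : Fin N => Metric.closedBall (0 : ℂ) 1) :=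
    isCompact_univ_pi fun _ => isCompact_univ_pi fun _ => isCompact_closedBall _ _
  refine isCompact_iff_compactSpace.mp (hcompact.of_isClosed_subset hclosed fun U hU => ?_)
  exact fun i _ j _ => mem_closedBall_zero_iff.mpr (entry_norm_bound_of_unitary hU i j)

/-- The compact space `U_N^K`, with factors indexed by `ℤ/K`. -/
abbrev UnitaryPower (N K : ℕ) : Type := ZMod K → Matrix.unitaryGroup (Fin N) ℂ

/-- The map `(z_c)_c ↦ (z_{c+j})_c` on `U_N^K`. -/
def UnitaryPower.shift (N K : ℕ) (j : ZMod K) : UnitaryPower N K ≃ₜ UnitaryPower N K where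
  toFun z c := z (c + j)
  invFun z c := z (c - j)
  left_inv z := by simp
  right_inv z := by simp
  continuous_toFun := by fun_prop
  continuous_invFun := by fun_prop

/-- The action of the cyclic group `ℤ/K` on `C(U_N^K)` coming from the cyclic permutation of the
factors: the generator `τ` acts on `U_N^K` by `(τ z)_c = z_{c-1}`, and hence acts
on functions by `(τ f)(z) = f (τ⁻¹ z)`, where `(τ⁻¹ z)_c = z_{c+1}`. -/
def cyclicAction (N K : ℕ) :
    Multiplicative (ZMod K) →* (C(UnitaryPower N K, ℂ) ≃⋆ₐ[ℂ] C(UnitaryPower N K, ℂ)) where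
  toFun j := (UnitaryPower.shift N K j.toAdd).compStarAlgEquiv' ℂ ℂ
  map_one' := by
    ext f z
    exact congrArg f (funext fun c => congrArg z (add_zero c))
  map_mul' i j := by
    ext f z
    refine congrArg f (funext fun c => congrArg z ?_)
    change c + (i.toAdd + j.toAdd) = c + j.toAdd + i.toAdd
    ring

theorem cyclicAction_apply {N K : ℕ} (j : Multiplicative (ZMod K)) (f : C(UnitaryPower N K, ℂ))
    (z : UnitaryPower N K) : cyclicAction N K j f z = f fun c => z (c + j.toAdd) :=
  rfl

/-- The coordinate function `a i j c : z ↦ (z_c) i j` on `U_N^K`. -/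
def unitaryCoord {N K : ℕ} (i j : Fin N) (c : ZMod K) : C(UnitaryPower N K, ℂ) where
  toFun z := (z c : Matrix (Fin N) (Fin N) ℂ) i j
  continuous_toFun := by
    have h : Continuous fun z : UnitaryPower N K => (z c : Matrix (Fin N) (Fin N) ℂ) :=
      continuous_subtype_val.comp (continuous_apply c)
    exact h.matrix_elem i j

end CyclicAction

end

/-! Existence of `π` only needs the relations. Moving every τ to the right turns a word of length n
in the a_{ij,0} ⊗ τ into a product of coordinate functions tensored with τ^n, so the words of length
K lie in the commutative algebra C(U_N^K) ⊗ 1.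

Injectivity comes from a gauge action. The K-th roots of unity act on the source by u_ij ↦ ζ u_ij,
and `π` intertwines this with the dual action on the crossed product (`toCrossedProduct_gauge`). Let
B be the fixed algebra. If π(x) = 0, then the orbit sum of x⋆x lies in B and is killed by `π`. So if
`π` is injective on B, this sum of positive elements is zero, and hence x = 0.

B is the closure of the `*`-algebra generated by the K-letter words
(`fixedAlgebra_le_topologicalClosure`). Unitarity makes these words commute with each other's
adjoints as well, so B is commutative. By Gelfand duality it remains to see that every character χ
of B is evaluation of `π` at a point of U_N^K (`exists_evalFixed_eq`).

The numbers χ(u_ij u_kl⋆) form a system of matrix units in M_N(ℂ), so they equal Z_ij times the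
conjugate of Z_kl for some unitary Z (`exists_unitary_of_matrixUnits`). For longer words there is an
endomorphism σ of B with σ(b) u_ij = u_ij b (`conjHom`). The unitaries attached to χ, χ∘σ, χ∘σ², …
give χ on every product of a K-letter word and the adjoint of another. This fixes χ on the words
themselves up to one phase, which is absorbed into the first unitary.

For N = 0 there are no generators, and the source consists of scalars. -/

noncomputable section

/-! ### Universal properties of the free `*`-algebra and of universal C⋆-algebras -/

namespace FreeStarAlgebra

variable {X D : Type*} [Ring D] [StarRing D] [Algebra ℂ D]

/-- The underlying algebra homomorphism of `FreeStarAlgebra.lift`. -/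
def liftAlgHom (f : X → D) : FreeStarAlgebra X →ₐ[ℂ] D :=
  (FreeAlgebra.lift ℂ fun y : X × Bool => if y.2 then star (f y.1) else f y.1 :
    FreeAlgebra ℂ (X × Bool) →ₐ[ℂ] D)

theorem liftAlgHom_letter (f : X → D) (y : X × Bool) :
    liftAlgHom f (letter y) = if y.2 then star (f y.1) else f y.1 :=
  FreeAlgebra.lift_ι_apply (R := ℂ) _ y

theorem star_algebraMap (c : ℂ) :
    star (algebraMap ℂ (FreeStarAlgebra X) c) = algebraMap ℂ _ (star c) := by
  rw [star_def, starHom_algebraMap]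
  rfl

/-- The universal property of the free `*`-algebra. -/
def lift [StarModule ℂ D] (f : X → D) : FreeStarAlgebra X →⋆ₐ[ℂ] D where
  __ := liftAlgHom f
  map_star' a := by
    change liftAlgHom f (star a) = star (liftAlgHom f a)
    induction a using FreeStarAlgebra.induction with
    | scalar c => rw [star_algebraMap, AlgHom.commutes, AlgHom.commutes, algebraMap_star_comm]
    | let_ y =>
      obtain ⟨x, b⟩ := y
      cases b <;> simp [star_letter, liftAlgHom_letter]
    | mul a b ha hb => rw [star_mul, map_mul, map_mul, star_mul, ha, hb]
    | add a b ha hb => rw [star_add, map_add, map_add, star_add, ha, hb]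

@[simp]
theorem lift_gen [StarModule ℂ D] (f : X → D) (x : X) : lift f (gen x) = f x :=
  liftAlgHom_letter f (x, false)

end FreeStarAlgebra

section UniversalProperty

variable {𝒜 : Type*} [Ring 𝒜] [StarRing 𝒜] [Algebra ℂ 𝒜]

namespace CStarSeminorm

/-- The canonical map into the completion, as a `*`-homomorphism. -/
def ofHom (p : CStarSeminorm 𝒜) : 𝒜 →⋆ₐ[ℂ] p.Completion where
  toFun := p.of
  map_one' := Completion.of_one p
  map_mul' := Completion.of_mul p
  map_zero' := Completion.of_zero p
  map_add' := Completion.of_add p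
  commutes' c := by
    rw [Algebra.algebraMap_eq_smul_one, Completion.of_smul, Completion.of_one,
      Algebra.algebraMap_eq_smul_one]
  map_star' a := (Completion.star_of p a).symm

variable {D : Type*} [CStarAlgebra D]

/-- The `C⋆`-seminorm induced by a `*`-homomorphism into a `C⋆`-algebra. -/
def induced (φ : 𝒜 →⋆ₐ[ℂ] D) : CStarSeminorm 𝒜 where
  toFun a := ‖φ a‖
  map_zero' := by simp
  add_le' a b := by rw [map_add]; exact norm_add_le _ _
  neg' a := by simp
  smul' c a := by rw [map_smul, norm_smul]
  mul_le' a b := by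
    rw [map_mul]
    exact norm_mul_le _ _
  star_mul_self' a := by
    rw [map_mul, map_star, CStarRing.norm_star_mul_self]

theorem induced_apply (φ : 𝒜 →⋆ₐ[ℂ] D) (a : 𝒜) : induced φ a = ‖φ a‖ := rfl

/-- A `*`-homomorphism, on the seminormed copy of the `*`-algebra. -/
def carrierHom (p : CStarSeminorm 𝒜) (φ : 𝒜 →⋆ₐ[ℂ] D) : p.Carrier →+* D :=
  (φ : 𝒜 →+* D)

theorem continuous_carrierHom (p : CStarSeminorm 𝒜) (φ : 𝒜 →⋆ₐ[ℂ] D) (h : ∀ a, ‖φ a‖ ≤ p a) :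
    Continuous (p.carrierHom φ) :=
  AddMonoidHomClass.continuous_of_bound (p.carrierHom φ) 1 fun a => by
    rw [one_mul]
    exact h a

/-- The extension of a contractive `*`-homomorphism to the completion, as a ring homomorphism. -/
def Completion.liftRingHom (p : CStarSeminorm 𝒜) (φ : 𝒜 →⋆ₐ[ℂ] D) (h : ∀ a, ‖φ a‖ ≤ p a) :
    p.Completion →+* D :=
  UniformSpace.Completion.extensionHom (p.carrierHom φ) (p.continuous_carrierHom φ h)

theorem Completion.liftRingHom_of (p : CStarSeminorm 𝒜) (φ : 𝒜 →⋆ₐ[ℂ] D)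
    (h : ∀ a, ‖φ a‖ ≤ p a) (a : 𝒜) : Completion.liftRingHom p φ h (p.of a) = φ a :=
  UniformSpace.Completion.extensionHom_coe (p.carrierHom φ) (p.continuous_carrierHom φ h) a

theorem Completion.continuous_liftRingHom (p : CStarSeminorm 𝒜) (φ : 𝒜 →⋆ₐ[ℂ] D)
    (h : ∀ a, ‖φ a‖ ≤ p a) : Continuous (Completion.liftRingHom p φ h) :=
  UniformSpace.Completion.continuous_extension

/-- A `*`-homomorphism that is contractive for `p` extends to the completion. -/
def Completion.lift (p : CStarSeminorm 𝒜) (φ : 𝒜 →⋆ₐ[ℂ] D) (h : ∀ a, ‖φ a‖ ≤ p a) :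
    p.Completion →⋆ₐ[ℂ] D where
  __ := Completion.liftRingHom p φ h
  commutes' c := by
    change Completion.liftRingHom p φ h (algebraMap ℂ _ c) = _
    rw [Algebra.algebraMap_eq_smul_one, ← Completion.of_one p, ← Completion.of_smul,
      Completion.liftRingHom_of, map_smul, map_one, Algebra.algebraMap_eq_smul_one]
  map_star' a := (Completion.denseRange_of p).induction_on
    (p := fun a => Completion.liftRingHom p φ h (star a) = star (Completion.liftRingHom p φ h a)) a
    (isClosed_eq ((Completion.continuous_liftRingHom p φ h).comp (Completion.continuous_star p))
      (Completion.continuous_liftRingHom p φ h).star)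
    (fun a => by
      rw [Completion.star_of, Completion.liftRingHom_of, Completion.liftRingHom_of, map_star])

theorem Completion.lift_of (p : CStarSeminorm 𝒜) (φ : 𝒜 →⋆ₐ[ℂ] D) (h : ∀ a, ‖φ a‖ ≤ p a)
    (a : 𝒜) : Completion.lift p φ h (p.of a) = φ a :=
  Completion.liftRingHom_of p φ h a

end CStarSeminorm

variable {D : Type*} [CStarAlgebra D] (R : Set 𝒜) [BoundedRelations R]

theorem maxCStarSeminorm_eq_zero {r : 𝒜} (hr : r ∈ R) : maxCStarSeminorm R r = 0 := by
  change ⨆ p : CStarSeminorm.Compatible R, p.1 r = 0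
  simp only [fun p : CStarSeminorm.Compatible R => p.2 r hr, ciSup_const]

/-- The seminorm ‖φ ·‖ is itself compatible with `R`, so it is one of those over which the supremum
is taken. -/
theorem norm_le_maxCStarSeminorm (φ : 𝒜 →⋆ₐ[ℂ] D) (h : ∀ r ∈ R, φ r = 0) (a : 𝒜) :
    ‖φ a‖ ≤ maxCStarSeminorm R a :=
  le_ciSup (BoundedRelations.bddAbove (R := R) a)
    (⟨CStarSeminorm.induced φ, fun r hr => by
      rw [CStarSeminorm.induced_apply, h r hr, norm_zero]⟩ : CStarSeminorm.Compatible R)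

/-- The universal property of the universal `C⋆`-algebra. -/
def UniversalCStarAlgebra.lift (φ : 𝒜 →⋆ₐ[ℂ] D) (h : ∀ r ∈ R, φ r = 0) :
    UniversalCStarAlgebra R →⋆ₐ[ℂ] D :=
  CStarSeminorm.Completion.lift _ φ (norm_le_maxCStarSeminorm R φ h)

theorem UniversalCStarAlgebra.lift_of (φ : 𝒜 →⋆ₐ[ℂ] D) (h : ∀ r ∈ R, φ r = 0) (a : 𝒜) :
    UniversalCStarAlgebra.lift R φ h ((maxCStarSeminorm R).of a) = φ a :=
  CStarSeminorm.Completion.lift_of _ φ _ a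

end UniversalProperty

/-! ### The defining relations as matrix identities -/

open Matrix in
/-- A matrix over a `*`-ring that satisfies the defining relations of `C(U_{N,K}^*)`. -/
structure IsHalfLiberated {N : ℕ} {D : Type*} [Ring D] [StarRing D] (K : ℕ)
    (v : Matrix (Fin N) (Fin N) D) : Prop where
  mul_conjTranspose : v * vᴴ = 1
  conjTranspose_mul : vᴴ * v = 1
  transpose_mul : vᵀ * v.map star = 1
  mul_transpose : v.map star * vᵀ = 1
  commute : ∀ i j k l : Fin K → Fin N,
    Commute (List.ofFn fun s => v (i s) (j s)).prod (List.ofFn fun s => v (k s) (l s)).prod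

namespace HalfLiberatedUnitary

open FreeStarAlgebra

variable {N K : ℕ} {D : Type*} [CStarAlgebra D]

theorem map_freeProduct {D : Type*} [Ring D] [StarRing D] [Algebra ℂ D]
    (φ : FreeStarAlgebra (Fin N × Fin N) →⋆ₐ[ℂ] D) (i j : Fin K → Fin N) :
    φ (freeProduct i j) = (List.ofFn fun s => φ (gen (i s, j s))).prod := by
  rw [freeProduct, map_list_prod, List.map_ofFn]
  rfl

/-- Used in both directions: forwards for the canonical generators, backwards to build morphisms out
of C(U_{N,K}^*). -/
theorem forall_relations_iff {D : Type*} [Ring D] [StarRing D] [Algebra ℂ D]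
    (φ : FreeStarAlgebra (Fin N × Fin N) →⋆ₐ[ℂ] D) :
    (∀ r ∈ halfLiberatedRelations N K, φ r = 0) ↔
      IsHalfLiberated K (Matrix.of fun i j => φ (gen (i, j))) := by
  have h1 (A B : Matrix (Fin N) (Fin N) (FreeStarAlgebra (Fin N × Fin N))) (i j : Fin N) :
      φ ((A * B - 1) i j) = 0 ↔ (A.map φ * B.map φ) i j = (1 : Matrix (Fin N) (Fin N) D) i j := by
    rw [Matrix.sub_apply, map_sub, sub_eq_zero, Matrix.mul_apply, map_sum, Matrix.mul_apply,
      Matrix.one_apply, Matrix.one_apply, apply_ite φ, map_one, map_zero]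
    simp only [map_mul, Matrix.map_apply]
  have hm : (freeMatrix N).map φ = Matrix.of fun i j => φ (gen (i, j)) := rfl
  have hH : (freeMatrix N).conjTranspose.map φ =
      (Matrix.of fun i j => φ (gen (i, j))).conjTranspose := by
    ext i j
    exact map_star φ _
  have hT : (freeMatrix N).transpose.map φ =
      (Matrix.of fun i j => φ (gen (i, j))).transpose := rfl
  have hS : ((freeMatrix N).map star).map φ =
      (Matrix.of fun i j => φ (gen (i, j))).map star := by
    ext i j
    exact map_star φ _
  constructor
  · intro h
    refine ⟨?_, ?_, ?_, ?_, fun i j k l => ?_⟩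
    · ext i j
      rw [← hH, ← hm, ← h1]
      exact h _ (Or.inl ⟨i, j, Or.inl rfl⟩)
    · ext i j
      rw [← hH, ← hm, ← h1]
      exact h _ (Or.inl ⟨i, j, Or.inr (Or.inl rfl)⟩)
    · ext i j
      rw [← hT, ← hS, ← h1]
      exact h _ (Or.inl ⟨i, j, Or.inr (Or.inr (Or.inl rfl))⟩)
    · ext i j
      rw [← hT, ← hS, ← h1]
      exact h _ (Or.inl ⟨i, j, Or.inr (Or.inr (Or.inr rfl))⟩)
    · have := h _ (Or.inr ⟨i, j, k, l, rfl⟩)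
      rw [map_sub, map_mul, map_mul, sub_eq_zero, map_freeProduct, map_freeProduct] at this
      exact this
  · rintro ⟨h1', h2, h3, h4, h5⟩ r (⟨i, j, rfl | rfl | rfl | rfl⟩ | ⟨i, j, k, l, rfl⟩)
    · rw [h1, hH, hm, h1']
    · rw [h1, hH, hm, h2]
    · rw [h1, hT, hS, h3]
    · rw [h1, hT, hS, h4]
    · rw [map_sub, map_mul, map_mul, sub_eq_zero, map_freeProduct, map_freeProduct]
      exact h5 i j k l

variable (N K) in
/-- The canonical map from the free `*`-algebra to `C(U_{N,K}^*)`. -/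
def ofFree : FreeStarAlgebra (Fin N × Fin N) →⋆ₐ[ℂ] HalfLiberatedUnitary N K :=
  (maxCStarSeminorm (halfLiberatedRelations N K)).ofHom

theorem denseRange_ofFree : DenseRange (ofFree N K) :=
  CStarSeminorm.Completion.denseRange_of _

variable (N K) in
theorem isHalfLiberated_u :
    IsHalfLiberated K (Matrix.of fun i j => (u i j : HalfLiberatedUnitary N K)) := by
  refine (forall_relations_iff (ofFree N K)).mp fun r hr => ?_
  change (maxCStarSeminorm (halfLiberatedRelations N K)).of r = 0
  rw [← norm_eq_zero, CStarSeminorm.Completion.norm_of, maxCStarSeminorm_eq_zero _ hr]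

/-- The universal property of `C(U_{N,K}^*)`. -/
def lift (v : Matrix (Fin N) (Fin N) D) (h : IsHalfLiberated K v) :
    HalfLiberatedUnitary N K →⋆ₐ[ℂ] D :=
  UniversalCStarAlgebra.lift _ (FreeStarAlgebra.lift fun x : Fin N × Fin N => v x.1 x.2)
    ((forall_relations_iff _).mpr <| by
      simp only [FreeStarAlgebra.lift_gen]
      exact h)

theorem lift_u (v : Matrix (Fin N) (Fin N) D) (h : IsHalfLiberated K v) (i j : Fin N) :
    lift v h (u i j) = v i j :=
  (UniversalCStarAlgebra.lift_of _ _ _ _).trans (FreeStarAlgebra.lift_gen _ _)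

/-- An induction principle for the image of the free `*`-algebra. -/
theorem ofFree_induction {P : HalfLiberatedUnitary N K → Prop}
    (scalar : ∀ c : ℂ, P (algebraMap ℂ _ c)) (gen : ∀ i j, P (u i j))
    (star_gen : ∀ i j, P (star (u i j)))
    (mul : ∀ a b, P a → P b → P (a * b)) (add : ∀ a b, P a → P b → P (a + b))
    (a : FreeStarAlgebra (Fin N × Fin N)) : P (ofFree N K a) := by
  induction a using FreeStarAlgebra.induction with
  | scalar c =>
    rw [show ofFree N K (algebraMap ℂ _ c) = algebraMap ℂ _ c from
      AlgHomClass.commutes (ofFree N K) c]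
    exact scalar c
  | let_ y =>
    obtain ⟨⟨i, j⟩, b⟩ := y
    cases b with
    | false => exact gen i j
    | true =>
      have : letter ((i, j), true) = star (FreeStarAlgebra.gen (i, j)) := by
        simp [FreeStarAlgebra.gen, star_letter]
      rw [this, map_star]
      exact star_gen i j
  | mul a b ha hb => rw [map_mul]; exact mul _ _ ha hb
  | add a b ha hb => rw [map_add]; exact add _ _ ha hb

-- `*`-homomorphisms between C⋆-algebras are automatically continuous, and noncommutative
-- polynomials are dense.
open scoped CStarAlgebra in
theorem hom_ext {φ ψ : HalfLiberatedUnitary N K →⋆ₐ[ℂ] D}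
    (h : ∀ i j, φ (u i j) = ψ (u i j)) : φ = ψ := by
  have hφ : Continuous φ := map_continuous φ
  have hψ : Continuous ψ := map_continuous ψ
  refine DFunLike.coe_injective (denseRange_ofFree.equalizer hφ hψ (funext fun a => ?_))
  refine ofFree_induction (P := fun x => φ x = ψ x) ?_ h ?_ ?_ ?_ a
  · intro c
    rw [AlgHomClass.commutes φ, AlgHomClass.commutes ψ]
  · intro i j
    rw [map_star, map_star, h]
  · intro a b ha hb
    rw [map_mul, map_mul, ha, hb]
  · intro a b ha hb
    rw [map_add, map_add, ha, hb]

end HalfLiberatedUnitary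

end

/-! ### Matrix units in M_n(ℂ) -/

noncomputable section

section MatrixUnits

/-- A system of matrix units `F · i · k` in `M_n(ℂ)` compatible with the involution is conjugate
to the standard one by a unitary matrix. -/
theorem exists_unitary_of_matrixUnits {n : Type*} [Fintype n] [DecidableEq n] [Nonempty n]
    (F : n → n → n → n → ℂ)
    (hmul : ∀ j i k k' p m, ∑ l, F j i l k * F l k' p m = if k = k' then F j i p m else 0)
    (hone : ∀ j l, ∑ i, F j i l i = if j = l then 1 else 0)
    (hstar : ∀ j i l k, star (F j i l k) = F l k j i) :
    ∃ Z ∈ Matrix.unitaryGroup n ℂ, ∀ j i l k, F j i l k = Z j i * star (Z l k) := by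
  obtain ⟨o⟩ := ‹Nonempty n›
  -- Write E_ik for the matrix with (j, l) entry `F j i l k`. As E_oo is a self-adjoint idempotent,
  -- its diagonal entries are squared row norms.
  have hdiag (p : n) : F p o p o = ((∑ l, ‖F p o l o‖ ^ 2 : ℝ) : ℂ) := by
    have h := hmul p o o o p o
    rw [if_pos rfl] at h
    rw [← h]
    push_cast
    refine Finset.sum_congr rfl fun l _ => ?_
    rw [← hstar p o l o, Complex.star_def, Complex.mul_conj, Complex.normSq_eq_norm_sq]
    push_cast
    rfl
  -- If the diagonal of E_oo vanished, then so would E_oo, hence every E_im = E_io E_oo E_om,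
  -- contradicting ∑ E_ii = 1.
  obtain ⟨p, hp⟩ : ∃ p, F p o p o ≠ 0 := by
    by_contra! h0
    have h1 (p l : n) : F p o l o = 0 := by
      have h2 := hdiag p
      rw [h0 p, eq_comm, Complex.ofReal_eq_zero,
        Finset.sum_eq_zero_iff_of_nonneg fun _ _ => sq_nonneg _] at h2
      simpa using h2 l (Finset.mem_univ l)
    have h2 (l i q m : n) : F l o q m = 0 := by
      have h3 := hmul l o o o q m
      rw [if_pos rfl] at h3
      rw [← h3]
      exact Finset.sum_eq_zero fun r _ => by rw [h1, zero_mul]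
    have h3 (j i : n) : F j i j i = 0 := by
      have h4 := hmul j i o o j i
      rw [if_pos rfl] at h4
      rw [← h4]
      exact Finset.sum_eq_zero fun r _ => by rw [h2 r o, mul_zero]
    have h4 := hone o o
    rw [if_pos rfl, Finset.sum_eq_zero fun i _ => h3 o i] at h4
    exact zero_ne_one h4
  set r : ℝ := ∑ l, ‖F p o l o‖ ^ 2 with hr
  have hr0 : 0 < r := by
    refine lt_of_le_of_ne (Finset.sum_nonneg fun _ _ => sq_nonneg _) fun h => hp ?_
    rw [hdiag, ← hr, ← h, Complex.ofReal_zero]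
  set c : ℂ := Complex.ofReal (√r)⁻¹ with hc
  have hcs : star c = c := Complex.conj_ofReal _
  have hcr : c * c * F p o p o = 1 := by
    rw [hdiag, ← hr, hc, ← Complex.ofReal_mul, ← Complex.ofReal_mul, ← mul_inv,
      Real.mul_self_sqrt hr0.le, inv_mul_cancel₀ hr0.ne', Complex.ofReal_one]
  -- Column i is E_io applied to the basis vector e_p, and `c` normalizes it to length one.
  let Z : Matrix n n ℂ := Matrix.of fun j i => c * F j i p o
  have hZe (j i : n) : Z j i = c * F j i p o := rfl
  have hZ : Z ∈ Matrix.unitaryGroup n ℂ := by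
    rw [Matrix.mem_unitaryGroup_iff']
    ext k m
    have h1 (l : n) : star Z k l * Z l m = c * c * (F p o l k * F l m p o) := by
      rw [Matrix.star_apply, hZe, hZe, star_mul', hcs, hstar]
      ring
    rw [Matrix.mul_apply, Finset.sum_congr rfl fun l _ => h1 l, ← Finset.mul_sum, hmul,
      Matrix.one_apply]
    split_ifs
    · exact hcr
    · exact mul_zero _
  refine ⟨Z, hZ, fun j i q k => ?_⟩
  have hZ' (l q : n) : ∑ m, Z l m * star (Z q m) = if l = q then 1 else 0 := by
    have h1 := congrFun (congrFun (Matrix.mem_unitaryGroup_iff.mp hZ) l) q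
    rwa [Matrix.mul_apply, Matrix.one_apply] at h1
  -- E_ik sends column m of `Z` to column i if k = m and to 0 otherwise. Inserting Z Z⋆ = 1 then
  -- recovers E_ik itself.
  have hint (m : n) : ∑ l, F j i l k * Z l m = if k = m then Z j i else 0 := by
    have h1 (l : n) : F j i l k * Z l m = c * (F j i l k * F l m p o) := by
      rw [hZe]
      ring
    rw [Finset.sum_congr rfl fun l _ => h1 l, ← Finset.mul_sum, hmul, mul_ite, mul_zero]
    rfl
  calc F j i q k = ∑ l, F j i l k * ∑ m, Z l m * star (Z q m) := by
        simp only [hZ']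
        simp
    _ = ∑ m, (∑ l, F j i l k * Z l m) * star (Z q m) := by
      simp only [Finset.mul_sum, Finset.sum_mul]
      rw [Finset.sum_comm]
      exact Finset.sum_congr rfl fun _ _ => Finset.sum_congr rfl fun _ _ => (mul_assoc _ _ _).symm
    _ = Z j i * star (Z q k) := by
      simp only [hint]
      simp

end MatrixUnits

/-! ### Words in a unitary matrix -/

section Words

variable {N : ℕ} {A : Type*} [Ring A]

/-- The word `v (I 0) (J 0) * ⋯ * v (I (n-1)) (J (n-1))` in the entries of `v`, that is, the
`(I, J)` entry of the `n`-th tensor power of `v`. -/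
def matrixWord (v : Matrix (Fin N) (Fin N) A) {n : ℕ} (I J : Fin n → Fin N) : A :=
  (List.ofFn fun s => v (I s) (J s)).prod

variable (v : Matrix (Fin N) (Fin N) A)

/-- The set of the words of length `n` in the entries of `v`. -/
def wordSet (n : ℕ) (v : Matrix (Fin N) (Fin N) A) : Set A :=
  Set.range fun p : (Fin n → Fin N) × (Fin n → Fin N) => matrixWord v p.1 p.2

@[simp]
theorem matrixWord_zero (I J : Fin 0 → Fin N) : matrixWord v I J = 1 := by
  simp [matrixWord]

theorem matrixWord_succ {n : ℕ} (I J : Fin (n + 1) → Fin N) :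
    matrixWord v I J = v (I 0) (J 0) * matrixWord v (Fin.tail I) (Fin.tail J) := by
  simp [matrixWord, List.ofFn_succ, Fin.tail]

theorem sum_fin_succ_arrow {M : Type*} [AddCommMonoid M] {n : ℕ} (f : (Fin (n + 1) → Fin N) → M) :
    ∑ I, f I = ∑ i, ∑ I : Fin n → Fin N, f (Fin.cons i I) := by
  rw [← Fintype.sum_prod_type']
  exact (Fintype.sum_equiv (Fin.consEquiv fun _ => Fin N) _ _ fun _ => rfl).symm

variable {v} [StarRing A]

open Matrix in
theorem sum_mul_star (h : v * vᴴ = 1) (i l : Fin N) :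
    ∑ j, v i j * star (v l j) = if i = l then 1 else 0 := by
  have := congrFun (congrFun h i) l
  rwa [Matrix.mul_apply, Matrix.one_apply] at this

open Matrix in
theorem sum_star_mul (h : vᴴ * v = 1) (j m : Fin N) :
    ∑ i, star (v i j) * v i m = if j = m then 1 else 0 := by
  have := congrFun (congrFun h j) m
  rwa [Matrix.mul_apply, Matrix.one_apply] at this

-- Tensor powers of a unitary are unitary. In a word times the adjoint of a word the last letters
-- meet first, so the sum over tails collapses before the sum over the first letter.
open Matrix in
theorem sum_matrixWord_mul_star (h : v * vᴴ = 1) {n : ℕ} (I L : Fin n → Fin N) :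
    ∑ J, matrixWord v I J * star (matrixWord v L J) = if I = L then 1 else 0 := by
  induction n with
  | zero => simp [Subsingleton.elim I L]
  | succ n ih =>
    have h1 (j : Fin N) (J : Fin n → Fin N) :
        matrixWord v I (Fin.cons j J) * star (matrixWord v L (Fin.cons j J)) =
          v (I 0) j * (matrixWord v (Fin.tail I) J * star (matrixWord v (Fin.tail L) J)) *
            star (v (L 0) j) := by
      rw [matrixWord_succ, matrixWord_succ, star_mul]
      simp only [Fin.cons_zero, Fin.tail_cons, mul_assoc]
    simp only [sum_fin_succ_arrow, h1, ← Finset.sum_mul, ← Finset.mul_sum, ih]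
    by_cases hT : Fin.tail I = Fin.tail L
    · simp only [if_pos hT, mul_one, sum_mul_star h]
      by_cases h0 : I 0 = L 0
      · have : I = L := by
          rw [← Fin.cons_self_tail I, ← Fin.cons_self_tail L, h0, hT]
        rw [if_pos h0, if_pos this]
      · rw [if_neg h0, if_neg fun hIL => h0 (congrFun hIL 0)]
    · rw [if_neg fun hIL => hT (congrArg Fin.tail hIL)]
      simp [hT]

-- Here the first letters meet in the middle, so the order of summation is exchanged before the
-- induction hypothesis applies.
open Matrix in
theorem sum_star_matrixWord_mul (h : vᴴ * v = 1) {n : ℕ} (J M : Fin n → Fin N) :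
    ∑ I, star (matrixWord v I J) * matrixWord v I M = if J = M then 1 else 0 := by
  induction n with
  | zero => simp [Subsingleton.elim J M]
  | succ n ih =>
    have h1 (i : Fin N) (I : Fin n → Fin N) :
        star (matrixWord v (Fin.cons i I) J) * matrixWord v (Fin.cons i I) M =
          star (matrixWord v I (Fin.tail J)) * (star (v i (J 0)) * v i (M 0)) *
            matrixWord v I (Fin.tail M) := by
      rw [matrixWord_succ, matrixWord_succ, star_mul]
      simp only [Fin.cons_zero, Fin.tail_cons, mul_assoc]
    simp only [sum_fin_succ_arrow, h1]
    rw [Finset.sum_comm]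
    simp only [← Finset.sum_mul, ← Finset.mul_sum, sum_star_mul h]
    by_cases h0 : J 0 = M 0
    · simp only [if_pos h0, mul_one, ih]
      by_cases hT : Fin.tail J = Fin.tail M
      · have : J = M := by
          rw [← Fin.cons_self_tail J, ← Fin.cons_self_tail M, h0, hT]
        rw [if_pos hT, if_pos this]
      · rw [if_neg hT, if_neg fun hJM => hT (congrArg Fin.tail hJM)]
    · rw [if_neg fun hJM => h0 (congrFun hJM 0)]
      simp [h0]

open Matrix in
/-- An element that commutes with all `n`-letter words commutes with their adjoints, which are the
entries of the inverse matrix. -/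
theorem commute_star_matrixWord (h : v * vᴴ = 1) (h' : vᴴ * v = 1) {n : ℕ} {x : A}
    (hx : ∀ I J : Fin n → Fin N, Commute x (matrixWord v I J)) (I J : Fin n → Fin N) :
    Commute x (star (matrixWord v I J)) := by
  -- Conjugating by the unitary matrix of words fixes `x`. Multiplying this back by the inverse
  -- matrix moves `x` across the adjoint of a word.
  have h1 (M : Fin n → Fin N) :
      ∑ L, star (matrixWord v L J) * x * matrixWord v L M = if J = M then x else 0 := by
    have (L : Fin n → Fin N) : star (matrixWord v L J) * x * matrixWord v L M =
        star (matrixWord v L J) * matrixWord v L M * x := by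
      rw [mul_assoc, (hx L M).eq, mul_assoc]
    simp only [this, ← Finset.sum_mul, sum_star_matrixWord_mul h', ite_mul, one_mul, zero_mul]
  calc x * star (matrixWord v I J)
      = ∑ M, (if J = M then x else 0) * star (matrixWord v I M) := by simp
    _ = ∑ L, star (matrixWord v L J) * x *
          ∑ M, matrixWord v L M * star (matrixWord v I M) := by
      simp only [← h1, Finset.sum_mul, Finset.mul_sum]
      rw [Finset.sum_comm]
      simp only [mul_assoc]
    _ = star (matrixWord v I J) * x := by
      simp [sum_matrixWord_mul_star h]

theorem IsHalfLiberated.wordSet_subset_centralizer {K : ℕ} (h : IsHalfLiberated K v) :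
    wordSet K v ∪ star (wordSet K v) ⊆ Set.centralizer (wordSet K v ∪ star (wordSet K v)) := by
  have h1 (I J I' J' : Fin K → Fin N) : Commute (matrixWord v I J) (matrixWord v I' J') :=
    h.commute I J I' J'
  have h2 (I J I' J' : Fin K → Fin N) :
      Commute (matrixWord v I J) (star (matrixWord v I' J')) :=
    commute_star_matrixWord h.mul_conjTranspose h.conjTranspose_mul (h1 I J) I' J'
  rintro x (⟨⟨I, J⟩, rfl⟩ | ⟨⟨I, J⟩, hx⟩) y (⟨⟨I', J'⟩, rfl⟩ | ⟨⟨I', J'⟩, hy⟩)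
  · exact h1 I' J' I J
  · rw [← star_eq_iff_star_eq.mp hy.symm]
    exact (h2 I J I' J').symm
  · rw [← star_eq_iff_star_eq.mp hx.symm]
    exact h2 I' J' I J
  · rw [← star_eq_iff_star_eq.mp hx.symm, ← star_eq_iff_star_eq.mp hy.symm]
    exact (h1 I' J' I J).star_star

end Words

end

/-! ### Reduction of polynomials to (word algebra) · (words) -/

noncomputable section

section Grading

variable {N : ℕ} {A : Type*} [Ring A] [Algebra ℂ A]

/-- The span of the entries of `v`. -/
def entrySpan (v : Matrix (Fin N) (Fin N) A) : Submodule ℂ A :=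
  Submodule.span ℂ (Set.range fun p : Fin N × Fin N => v p.1 p.2)

/-- The span of the adjoints of the entries of `v`. -/
def starEntrySpan [StarRing A] (v : Matrix (Fin N) (Fin N) A) : Submodule ℂ A :=
  Submodule.span ℂ (Set.range fun p : Fin N × Fin N => star (v p.1 p.2))

variable {v : Matrix (Fin N) (Fin N) A}

theorem entry_mem_entrySpan (i j : Fin N) : v i j ∈ entrySpan v :=
  Submodule.subset_span ⟨(i, j), rfl⟩

theorem star_entry_mem_starEntrySpan [StarRing A] (i j : Fin N) : star (v i j) ∈ starEntrySpan v :=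
  Submodule.subset_span ⟨(i, j), rfl⟩

theorem entrySpan_pow_le (n : ℕ) : entrySpan v ^ n ≤ Submodule.span ℂ (wordSet n v) := by
  rw [entrySpan, Submodule.span_pow, Submodule.span_le]
  intro a ha
  obtain ⟨f, rfl⟩ := Set.mem_pow.mp ha
  choose p hp using fun s => (f s).2
  refine Submodule.subset_span ⟨(fun s => (p s).1, fun s => (p s).2), ?_⟩
  simp only [matrixWord]
  exact congrArg List.prod (congrArg List.ofFn (funext hp))

variable [StarRing A]

/-- The (0, 0) entry of v v⋆ = 1 writes 1 as a sum of elements v_0j v_0j⋆. Nesting this n times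
gives the claim; an index 0 exists because N ≠ 0. -/
theorem one_le_entrySpan_pow_mul [NeZero N] (h : v * v.conjTranspose = 1) (n : ℕ) :
    1 ≤ entrySpan v ^ n * starEntrySpan v ^ n := by
  induction n with
  | zero => simp
  | succ n ih =>
    have h1 : 1 ≤ entrySpan v * starEntrySpan v := by
      rw [Submodule.one_le, ← if_pos (c := (0 : Fin N) = 0) (t := (1 : A)) (e := 0) rfl,
        ← sum_mul_star h]
      exact Submodule.sum_mem _ fun j _ => Submodule.mul_mem_mul (entry_mem_entrySpan _ _)
        (star_entry_mem_starEntrySpan _ _)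
    calc 1 ≤ entrySpan v ^ n * 1 * starEntrySpan v ^ n := by rwa [mul_one]
      _ ≤ entrySpan v ^ n * (entrySpan v * starEntrySpan v) * starEntrySpan v ^ n := by gcongr
      _ = _ := by rw [pow_succ, pow_succ']; simp only [mul_assoc]

theorem one_le_starEntrySpan_pow_mul [NeZero N] (h : v.conjTranspose * v = 1) (n : ℕ) :
    1 ≤ starEntrySpan v ^ n * entrySpan v ^ n := by
  induction n with
  | zero => simp
  | succ n ih =>
    have h1 : 1 ≤ starEntrySpan v * entrySpan v := by
      rw [Submodule.one_le, ← if_pos (c := (0 : Fin N) = 0) (t := (1 : A)) (e := 0) rfl,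
        ← sum_star_mul h]
      exact Submodule.sum_mem _ fun j _ => Submodule.mul_mem_mul
        (star_entry_mem_starEntrySpan _ _) (entry_mem_entrySpan _ _)
    calc 1 ≤ starEntrySpan v ^ n * 1 * entrySpan v ^ n := by rwa [mul_one]
      _ ≤ starEntrySpan v ^ n * (starEntrySpan v * entrySpan v) * entrySpan v ^ n := by gcongr
      _ = _ := by rw [pow_succ, pow_succ']; simp only [mul_assoc]

variable [StarModule ℂ A]

theorem star_mem_entrySpan_pow (n : ℕ) {x : A} (hx : x ∈ starEntrySpan v ^ n) :
    star x ∈ entrySpan v ^ n := by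
  induction n generalizing x with
  | zero =>
    rw [pow_zero, Submodule.mem_one] at hx ⊢
    obtain ⟨c, rfl⟩ := hx
    exact ⟨star c, algebraMap_star_comm c⟩
  | succ n ih =>
    have h1 {y : A} (hy : y ∈ starEntrySpan v) : star y ∈ entrySpan v := by
      induction hy using Submodule.span_induction with
      | mem y hy =>
        obtain ⟨p, rfl⟩ := hy
        rw [star_star]
        exact entry_mem_entrySpan _ _
      | zero => rw [star_zero]; exact zero_mem _
      | add y z _ _ hy hz => rw [star_add]; exact add_mem hy hz
      | smul c y _ hy => rw [star_smul]; exact Submodule.smul_mem _ _ hy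
    rw [pow_succ] at hx
    rw [pow_succ']
    induction hx using Submodule.mul_induction_on' with
    | mem_mul_mem a ha b hb => rw [star_mul]; exact Submodule.mul_mem_mul (h1 hb) (ih ha)
    | add a _ b _ ha hb => rw [star_add]; exact add_mem ha hb

/-- The `*`-algebra generated by the words of length `n` in the entries of `v`. -/
def wordAlgebra (n : ℕ) (v : Matrix (Fin N) (Fin N) A) : StarSubalgebra ℂ A :=
  StarAlgebra.adjoin ℂ (wordSet n v)

/-- The linear subspace underlying `wordAlgebra n v`. -/
abbrev wordSpace (n : ℕ) (v : Matrix (Fin N) (Fin N) A) : Submodule ℂ A :=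
  Subalgebra.toSubmodule (wordAlgebra n v).toSubalgebra

variable {K : ℕ}

theorem wordSpace_mul_self : wordSpace K v * wordSpace K v = wordSpace K v :=
  (wordAlgebra K v).toSubalgebra.isIdempotentElem_toSubmodule

theorem entrySpan_pow_le_wordSpace : entrySpan v ^ K ≤ wordSpace K v :=
  (entrySpan_pow_le K).trans (Submodule.span_le.mpr (StarAlgebra.subset_adjoin ℂ _))

theorem starEntrySpan_pow_le_wordSpace : starEntrySpan v ^ K ≤ wordSpace K v := fun x hx => by
  have h := entrySpan_pow_le_wordSpace (star_mem_entrySpan_pow K hx)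
  have h' : star (star x) ∈ wordAlgebra K v := star_mem h
  rwa [star_star] at h'

theorem wordSpace_pow_le (n : ℕ) : wordSpace K v ^ n ≤ wordSpace K v := by
  induction n with
  | zero =>
    rw [pow_zero, Submodule.one_le]
    exact one_mem (wordAlgebra K v)
  | succ n ih =>
    rw [pow_succ]
    exact (mul_le_mul' ih le_rfl).trans wordSpace_mul_self.le

theorem entrySpan_pow_mul_le_wordSpace (n : ℕ) : entrySpan v ^ (K * n) ≤ wordSpace K v := by
  rw [pow_mul]
  exact (pow_le_pow_left' entrySpan_pow_le_wordSpace n).trans (wordSpace_pow_le n)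

theorem starEntrySpan_pow_mul_le_wordSpace (n : ℕ) :
    starEntrySpan v ^ (K * n) ≤ wordSpace K v := by
  rw [pow_mul]
  exact (pow_le_pow_left' starEntrySpan_pow_le_wordSpace n).trans (wordSpace_pow_le n)

/-- Padding with (K-1)n further letters and as many adjoints in the middle makes both lengths
multiples of K. -/
theorem entrySpan_pow_mul_starEntrySpan_pow_le [NeZero N] [NeZero K]
    (h : v * v.conjTranspose = 1) (n : ℕ) :
    entrySpan v ^ n * starEntrySpan v ^ n ≤ wordSpace K v := by
  have hn : n + (K - 1) * n = K * n := by
    rw [Nat.sub_mul, one_mul]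
    exact Nat.add_sub_cancel' (Nat.le_mul_of_pos_left n (Nat.pos_of_neZero K))
  calc entrySpan v ^ n * starEntrySpan v ^ n
      = entrySpan v ^ n * 1 * starEntrySpan v ^ n := by rw [mul_one]
    _ ≤ entrySpan v ^ n * (entrySpan v ^ ((K - 1) * n) * starEntrySpan v ^ ((K - 1) * n)) *
          starEntrySpan v ^ n := by
      gcongr
      exact one_le_entrySpan_pow_mul h _
    _ = entrySpan v ^ (K * n) * starEntrySpan v ^ (K * n) := by
      rw [← hn, pow_add (entrySpan v), add_comm n, pow_add (starEntrySpan v)]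
      simp only [mul_assoc]
    _ ≤ wordSpace K v * wordSpace K v :=
      mul_le_mul' (entrySpan_pow_mul_le_wordSpace n) (starEntrySpan_pow_mul_le_wordSpace n)
    _ = wordSpace K v := wordSpace_mul_self

/-- The sum of the subspaces spanned by the products of an element of the word algebra and a
word. -/
def gradedSpan (K : ℕ) (v : Matrix (Fin N) (Fin N) A) : Submodule ℂ A := ⨆ n : ℕ, wordSpace K v * entrySpan v ^ n

theorem wordSpace_mul_entrySpan_pow_le (n : ℕ) :
    wordSpace K v * entrySpan v ^ n ≤ gradedSpan K v :=
  le_iSup (fun n : ℕ => wordSpace K v * entrySpan v ^ n) n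

theorem one_mem_gradedSpan : (1 : A) ∈ gradedSpan K v := by
  refine wordSpace_mul_entrySpan_pow_le 0 ?_
  rw [pow_zero, mul_one]
  exact one_mem (wordAlgebra K v)

theorem gradedSpan_mul_entrySpan_le : gradedSpan K v * entrySpan v ≤ gradedSpan K v := by
  rw [gradedSpan, Submodule.iSup_mul]
  refine iSup_le fun n => ?_
  rw [mul_assoc, ← pow_succ]
  exact wordSpace_mul_entrySpan_pow_le (n + 1)

/-- An adjoint letter lowers the degree by one: v^{n+1} v⋆ is completed to (v^{n+1} (v⋆)^{n+1}) vⁿ,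
whose bracket lies in the word algebra. -/
theorem gradedSpan_mul_starEntrySpan_le [NeZero N] [NeZero K] (h : v * v.conjTranspose = 1)
    (h' : v.conjTranspose * v = 1) : gradedSpan K v * starEntrySpan v ≤ gradedSpan K v := by
  rw [gradedSpan, Submodule.iSup_mul]
  refine iSup_le fun n => ?_
  cases n with
  | zero =>
    -- Degrees only matter modulo K, so from degree 0 one falls to K - 1: v⋆ is completed to (v⋆)^K
    -- v^{K-1}.
    refine le_trans ?_ (wordSpace_mul_entrySpan_pow_le (K - 1))
    calc wordSpace K v * entrySpan v ^ 0 * starEntrySpan v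
        = wordSpace K v * (starEntrySpan v * 1) := by rw [pow_zero, mul_one, mul_one]
      _ ≤ wordSpace K v * (starEntrySpan v *
            (starEntrySpan v ^ (K - 1) * entrySpan v ^ (K - 1))) := by
        gcongr
        exact one_le_starEntrySpan_pow_mul h' _
      _ = wordSpace K v * starEntrySpan v ^ K * entrySpan v ^ (K - 1) := by
        rw [← mul_pow_sub_one (NeZero.ne K) (starEntrySpan v)]
        simp only [mul_assoc]
      _ ≤ wordSpace K v * wordSpace K v * entrySpan v ^ (K - 1) := by
        gcongr
        exact starEntrySpan_pow_le_wordSpace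
      _ = wordSpace K v * entrySpan v ^ (K - 1) := by rw [wordSpace_mul_self]
  | succ n =>
    refine le_trans ?_ (wordSpace_mul_entrySpan_pow_le n)
    calc wordSpace K v * entrySpan v ^ (n + 1) * starEntrySpan v
        = wordSpace K v * (entrySpan v ^ (n + 1) * starEntrySpan v * 1) := by
          rw [mul_one, mul_assoc]
      _ ≤ wordSpace K v * (entrySpan v ^ (n + 1) * starEntrySpan v *
            (starEntrySpan v ^ n * entrySpan v ^ n)) := by
        gcongr
        exact one_le_starEntrySpan_pow_mul h' _
      _ = wordSpace K v * (entrySpan v ^ (n + 1) * starEntrySpan v ^ (n + 1)) *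
            entrySpan v ^ n := by
        rw [pow_succ' (starEntrySpan v)]
        simp only [mul_assoc]
      _ ≤ wordSpace K v * wordSpace K v * entrySpan v ^ n := by
        gcongr
        exact entrySpan_pow_mul_starEntrySpan_pow_le h _
      _ = wordSpace K v * entrySpan v ^ n := by rw [wordSpace_mul_self]

end Grading

end

/-! ### Characters of a commutative algebra normalized by a unitary matrix -/

noncomputable section

section Characters

variable {N : ℕ} {A : Type*} [Ring A] [StarRing A] [Algebra ℂ A] [StarModule ℂ A]

/-- A commutative `*`-subalgebra that contains the products `(v i j)⋆ * v k l`, and is stable under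
the maps `b ↦ v i j * b * (v k l)⋆`. -/
structure IsNormalized (B : StarSubalgebra ℂ A) (v : Matrix (Fin N) (Fin N) A) : Prop where
  mul_conjTranspose : v * v.conjTranspose = 1
  conjTranspose_mul : v.conjTranspose * v = 1
  comm : ∀ x ∈ B, ∀ y ∈ B, x * y = y * x
  conj_mem : ∀ b ∈ B, ∀ i j k l, v i j * b * star (v k l) ∈ B
  star_mul_mem : ∀ i j k l, star (v i j) * v k l ∈ B

namespace IsNormalized

variable {B : StarSubalgebra ℂ A} {v : Matrix (Fin N) (Fin N) A} (h : IsNormalized B v)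

include h

theorem mul_star_mem (i j k l : Fin N) : v i j * star (v k l) ∈ B := by
  simpa using h.conj_mem 1 (one_mem B) i j k l

/-- Such a product has the nested form v (w w'⋆) v'⋆, so `conj_mem` applies once per letter. The
words themselves need not lie in `B`. -/
theorem matrixWord_mul_star_mem {n : ℕ} (I J I' J' : Fin n → Fin N) :
    matrixWord v I J * star (matrixWord v I' J') ∈ B := by
  induction n with
  | zero => simp
  | succ n ih =>
    rw [matrixWord_succ, matrixWord_succ, star_mul, mul_assoc, ← mul_assoc (matrixWord v _ _),
      ← mul_assoc]
    exact h.conj_mem _ (ih _ _ _ _) _ _ _ _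

end IsNormalized

/-- The map `b ↦ ∑ j, v i j * b * (v i j)⋆`. -/
def conjSum (v : Matrix (Fin N) (Fin N) A) (i : Fin N) (b : A) : A :=
  ∑ j, v i j * b * star (v i j)

namespace IsNormalized

variable {B : StarSubalgebra ℂ A} {v : Matrix (Fin N) (Fin N) A} (h : IsNormalized B v)

include h

theorem conjSum_mem (o : Fin N) {b : A} (hb : b ∈ B) : conjSum v o b ∈ B :=
  sum_mem fun _ _ => h.conj_mem _ hb _ _ _ _

/-- Since (v_ok)⋆ v_ij lies in the commutative algebra `B`, it can be exchanged with b, and the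
remaining ∑ v_ok (v_ok)⋆ is 1. This relation makes `conjSum` multiplicative on `B`. -/
theorem conjSum_mul (o : Fin N) {b : A} (hb : b ∈ B) (i j : Fin N) :
    conjSum v o b * v i j = v i j * b := by
  have h1 (k : Fin N) : v o k * b * star (v o k) * v i j = v o k * star (v o k) * (v i j * b) := by
    rw [mul_assoc, mul_assoc, h.comm b hb _ (h.star_mul_mem _ _ _ _)]
    simp only [mul_assoc]
  rw [conjSum, Finset.sum_mul, Finset.sum_congr rfl fun k _ => h1 k, ← Finset.sum_mul,
    sum_mul_star h.mul_conjTranspose, if_pos rfl, one_mul]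

/-- The endomorphism of the commutative subalgebra implemented by the matrix `v`. -/
def conjHom (o : Fin N) : B →⋆ₐ[ℂ] B where
  toFun b := ⟨conjSum v o b, h.conjSum_mem o b.2⟩
  map_one' := by
    ext
    simp [conjSum, sum_mul_star h.mul_conjTranspose]
  map_mul' a b := by
    ext
    change conjSum v o (a * b : A) = conjSum v o a * conjSum v o b
    rw [conjSum, conjSum.eq_1 v o b, Finset.mul_sum]
    refine Finset.sum_congr rfl fun j _ => ?_
    simp only [← mul_assoc]
    rw [h.conjSum_mul o a.2]
  map_zero' := by
    ext
    simp [conjSum]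
  map_add' a b := by
    ext
    simp [conjSum, mul_add, add_mul, Finset.sum_add_distrib]
  commutes' c := by
    ext
    change conjSum v o (algebraMap ℂ A c) = algebraMap ℂ A c
    simp only [conjSum, ← Algebra.commutes c]
    simp only [mul_assoc, ← Finset.mul_sum]
    rw [sum_mul_star h.mul_conjTranspose, if_pos rfl, mul_one]
  map_star' b := by
    ext
    simp [conjSum, star_sum, mul_assoc]

/-- In a product of two such values the inner factors (v_lk)⋆ v_lk' sum over l to 0 or 1, which is
the matrix unit relation. -/
theorem exists_unitary (χ : B →⋆ₐ[ℂ] ℂ) : ∃ Z : Matrix.unitaryGroup (Fin N) ℂ,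
    ∀ i j k l, χ ⟨v i j * star (v k l), h.mul_star_mem i j k l⟩ =
      (Z : Matrix (Fin N) (Fin N) ℂ) i j * star ((Z : Matrix (Fin N) (Fin N) ℂ) k l) := by
  obtain rfl | hN := N.eq_zero_or_pos
  · exact ⟨1, fun i => i.elim0⟩
  have : Nonempty (Fin N) := ⟨⟨0, hN⟩⟩
  refine (exists_unitary_of_matrixUnits
    (fun i j k l => χ ⟨v i j * star (v k l), h.mul_star_mem i j k l⟩) ?_ ?_ ?_).elim
    fun Z hZ => ⟨⟨Z, hZ.1⟩, hZ.2⟩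
  · intro j i k k' p m
    simp only [← map_mul, ← map_sum]
    rw [← map_zero χ, ← apply_ite χ]
    congr 1
    ext
    have h1 (l : Fin N) : v j i * star (v l k) * (v l k' * star (v p m)) =
        v j i * (star (v l k) * v l k') * star (v p m) := by simp only [mul_assoc]
    simp only [AddSubmonoidClass.coe_finsetSum, MulMemClass.mk_mul_mk, h1, ← Finset.sum_mul,
      ← Finset.mul_sum, sum_star_mul h.conjTranspose_mul]
    split_ifs <;> simp
  · intro j l
    rw [← map_sum, ← map_zero χ, ← map_one χ, ← apply_ite χ]
    congr 1
    ext
    simp only [AddSubmonoidClass.coe_finsetSum, sum_mul_star h.mul_conjTranspose]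
    split_ifs <;> rfl
  · intro j i l k
    rw [← map_star]
    congr 1
    ext
    change star (v j i * star (v l k)) = _
    rw [star_mul, star_star]

/-- The tail is pulled to the front by `conjHom`, so the first letter is governed by χ and the tails
by χ composed with `conjHom`, to which the induction hypothesis applies. -/
theorem exists_unitaries (χ : B →⋆ₐ[ℂ] ℂ) (n : ℕ) : ∃ Z : Fin n → Matrix.unitaryGroup (Fin N) ℂ,
    ∀ I J I' J' : Fin n → Fin N,
      χ ⟨matrixWord v I J * star (matrixWord v I' J'), h.matrixWord_mul_star_mem I J I' J'⟩ =
        (∏ s, (Z s : Matrix (Fin N) (Fin N) ℂ) (I s) (J s)) *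
          star (∏ s, (Z s : Matrix (Fin N) (Fin N) ℂ) (I' s) (J' s)) := by
  induction n generalizing χ with
  | zero =>
    refine ⟨fun _ => 1, fun I J I' J' => ?_⟩
    simp only [Finset.univ_eq_empty, Finset.prod_empty, star_one, mul_one, matrixWord_zero]
    exact map_one χ
  | succ n ih =>
    obtain rfl | hN := N.eq_zero_or_pos
    · exact ⟨fun _ => 1, fun I => (I 0).elim0⟩
    obtain ⟨Z, hZ⟩ := ih (χ.comp (h.conjHom ⟨0, hN⟩))
    obtain ⟨Y, hY⟩ := h.exists_unitary χ
    refine ⟨Fin.cons Y Z, fun I J I' J' => ?_⟩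
    have h1 : (⟨_, h.matrixWord_mul_star_mem I J I' J'⟩ : B) =
        h.conjHom ⟨0, hN⟩ ⟨_, h.matrixWord_mul_star_mem (Fin.tail I) (Fin.tail J) (Fin.tail I')
          (Fin.tail J')⟩ * ⟨_, h.mul_star_mem (I 0) (J 0) (I' 0) (J' 0)⟩ := by
      ext
      change matrixWord v I J * star (matrixWord v I' J') = conjSum v ⟨0, hN⟩ _ * (_ * _)
      rw [← mul_assoc, h.conjSum_mul _ (h.matrixWord_mul_star_mem _ _ _ _), matrixWord_succ,
        matrixWord_succ, star_mul]
      simp only [mul_assoc]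
    have h2 := hZ (Fin.tail I) (Fin.tail J) (Fin.tail I') (Fin.tail J')
    rw [StarAlgHom.comp_apply] at h2
    rw [h1, map_mul, h2, hY]
    simp only [Fin.prod_univ_succ, Fin.cons_zero, Fin.cons_succ, Fin.tail, star_mul']
    ring

/-- A character takes the word of length `n` to products of entries of unitary matrices. -/
theorem exists_unitaries_of_matrixWord_mem (χ : B →⋆ₐ[ℂ] ℂ) (n : ℕ) [NeZero n]
    (hmem : ∀ I J : Fin n → Fin N, matrixWord v I J ∈ B) :
    ∃ Z : Fin n → Matrix.unitaryGroup (Fin N) ℂ, ∀ I J : Fin n → Fin N,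
      χ ⟨matrixWord v I J, hmem I J⟩ = ∏ s, (Z s : Matrix (Fin N) (Fin N) ℂ) (I s) (J s) := by
  obtain rfl | hN := N.eq_zero_or_pos
  · exact ⟨fun _ => 1, fun I => (I 0).elim0⟩
  obtain ⟨Z, hZ⟩ := h.exists_unitaries χ n
  set f : (Fin n → Fin N) → (Fin n → Fin N) → ℂ := fun I J => χ ⟨_, hmem I J⟩ with hf
  set g : (Fin n → Fin N) → (Fin n → Fin N) → ℂ := fun I J =>
    ∏ s, (Z s : Matrix (Fin N) (Fin N) ℂ) (I s) (J s) with hg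
  -- Equal rank-one kernels f f⋆ = g g⋆ force f = c g with |c| = 1, as soon as f has a nonzero
  -- value. Unitarity of words provides one.
  have hfg (I J I' J' : Fin n → Fin N) : f I J * star (f I' J') = g I J * star (g I' J') := by
    rw [← hZ, hf, ← map_star, ← map_mul]
    rfl
  have hone (I : Fin n → Fin N) : ∑ J, f I J * star (f I J) = 1 := by
    simp only [hf, ← map_star, ← map_mul, ← map_sum]
    rw [← map_one χ]
    congr 1
    ext
    rw [AddSubmonoidClass.coe_finsetSum]
    exact (sum_matrixWord_mul_star h.mul_conjTranspose I I).trans (if_pos rfl)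
  obtain ⟨I', J', h0⟩ : ∃ I J, f I J ≠ 0 := by
    by_contra! h0
    have h1 := hone fun _ => ⟨0, hN⟩
    simp [h0] at h1
  set c : ℂ := star (g I' J') / star (f I' J') with hc
  have h0' : star (f I' J') ≠ 0 := star_ne_zero.mpr h0
  have hfc (I J : Fin n → Fin N) : f I J = c * g I J := by
    rw [hc, div_mul_eq_mul_div, eq_div_iff h0', hfg, mul_comm]
  have hcc : c * star c = 1 := by
    rw [hc, star_div₀, star_star, star_star, div_mul_div_comm, mul_comm, ← hfg, mul_comm (f _ _),
      div_self (mul_ne_zero h0' h0)]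
  have hcZ : c • (Z 0 : Matrix (Fin N) (Fin N) ℂ) ∈ Matrix.unitaryGroup (Fin N) ℂ := by
    rw [Matrix.mem_unitaryGroup_iff, star_smul, smul_mul_smul_comm, hcc, one_smul]
    exact Matrix.mem_unitaryGroup_iff.mp (Z 0).2
  -- The phase is absorbed into factor 0, which exists because n ≠ 0.
  refine ⟨Function.update Z 0 ⟨_, hcZ⟩, fun I J => ?_⟩
  refine (hfc I J).trans ?_
  change c * ∏ s, _ = _
  rw [← Finset.mul_prod_erase _ _ (Finset.mem_univ (0 : Fin n)),
    ← Finset.mul_prod_erase Finset.univ (fun s =>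
      ((Function.update Z 0 ⟨_, hcZ⟩ s : Matrix.unitaryGroup (Fin N) ℂ) :
        Matrix (Fin N) (Fin N) ℂ) (I s) (J s)) (Finset.mem_univ (0 : Fin n)),
    Function.update_self, ← mul_assoc]
  congr 1
  refine Finset.prod_congr rfl fun s hs => ?_
  rw [Function.update_of_ne (Finset.ne_of_mem_erase hs)]

end IsNormalized

end Characters

end

/-! ### The dual action and the relations in the crossed product -/

noncomputable section

theorem Circle.star_coe_mul_coe (c : Circle) : star (c : ℂ) * c = 1 := by
  rw [Complex.star_def, mul_comm, Complex.mul_conj, Circle.normSq_coe, Complex.ofReal_one]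

namespace CrossedProduct

variable {A G : Type*} [CStarAlgebra A] [Group G] (α : G →* (A ≃⋆ₐ[ℂ] A)) [DecidableEq G]

theorem single_apply (g h : G) (a : A) : single α g a h = if h = g then a else 0 := rfl

theorem one_eq_single : (1 : CrossedProduct α) = single α 1 1 := rfl

@[simp]
theorem single_zero (g : G) : single α g 0 = 0 :=
  funext fun _ => ite_self _

theorem single_sum {ι : Type*} (s : Finset ι) (g : G) (f : ι → A) :
    single α g (∑ i ∈ s, f i) = ∑ i ∈ s, single α g (f i) := by
  classical
  induction s using Finset.induction_on with
  | empty => simp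
  | insert i s hi ih =>
    rw [Finset.sum_insert hi, Finset.sum_insert hi, ← ih]
    funext h
    rw [add_apply, single_apply, single_apply, single_apply]
    split_ifs <;> simp

variable [Fintype G]

theorem single_mul_single (g h : G) (a b : A) :
    single α g a * single α h b = single α (g * h) (a * α g b) := by
  funext k
  rw [mul_apply, Finset.sum_eq_single g]
  · rw [single_apply, single_apply, single_apply, if_pos rfl]
    by_cases hk : k = g * h
    · rw [if_pos hk, if_pos (by rw [hk, inv_mul_cancel_left])]
    · rw [if_neg hk, if_neg fun hc => hk (by rw [← hc, mul_inv_cancel_left]), map_zero, mul_zero]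
  · intro x _ hx
    rw [single_apply, if_neg hx, zero_mul]
  · exact fun hg => absurd (Finset.mem_univ g) hg

theorem star_single (g : G) (a : A) : star (single α g a) = single α g⁻¹ (α g⁻¹ (star a)) := by
  funext k
  rw [star_apply, single_apply, single_apply]
  by_cases hk : k = g⁻¹
  · rw [if_pos hk, if_pos (by rw [hk, inv_inv]), hk]
  · rw [if_neg hk, if_neg fun hc => hk (by rw [← hc, inv_inv]), star_zero, map_zero]

theorem single_mul_star_single (g : G) (a b : A) :
    single α g a * star (single α g b) = single α 1 (a * star b) := by
  have h : α g (α g⁻¹ (star b)) = (α g * α g⁻¹) (star b) := rfl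
  rw [star_single, single_mul_single, mul_inv_cancel, h, ← map_mul, mul_inv_cancel, map_one]
  rfl

theorem star_single_mul_single (g : G) (a b : A) :
    star (single α g a) * single α g b = single α 1 (α g⁻¹ (star a * b)) := by
  rw [star_single, single_mul_single, inv_mul_cancel, map_mul]

/-- The dual action: a character `χ` of `G` acts by `a ⊗ g ↦ χ g a ⊗ g`. -/
def dualAction (χ : G →* Circle) : CrossedProduct α →⋆ₐ[ℂ] CrossedProduct α where
  toFun a g := (χ g : ℂ) • a g
  map_one' := by
    funext g
    rw [one_apply]
    split_ifs with hg
    · rw [hg, map_one, Circle.coe_one, one_smul]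
    · rw [smul_zero]
  map_mul' a b := by
    funext g
    change (χ g : ℂ) • (∑ h, _) = ∑ h, (χ h : ℂ) • a h * α h ((χ (h⁻¹ * g) : ℂ) • b (h⁻¹ * g))
    rw [Finset.smul_sum]
    refine Finset.sum_congr rfl fun h _ => ?_
    rw [map_smul, smul_mul_smul_comm, ← Circle.coe_mul, ← map_mul, mul_inv_cancel_left]
  map_zero' := funext fun _ => smul_zero _
  map_add' a b := funext fun _ => smul_add _ _ _
  commutes' c := by
    funext g
    rw [Algebra.algebraMap_eq_smul_one, smul_apply, one_apply]
    split_ifs with hg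
    · rw [hg, map_one, Circle.coe_one, one_smul]
    · rw [smul_zero, smul_zero]
  map_star' a := by
    funext g
    change (χ g : ℂ) • α g (star (a g⁻¹)) = α g (star ((χ g⁻¹ : ℂ) • a g⁻¹))
    rw [star_smul, map_smul, map_inv, Circle.coe_inv_eq_conj,
      Complex.star_def, Complex.conj_conj]

theorem dualAction_apply (χ : G →* Circle) (a : CrossedProduct α) (g : G) :
    dualAction α χ a g = (χ g : ℂ) • a g := rfl

theorem dualAction_single (χ : G →* Circle) (a : A) (g : G) :
    dualAction α χ (single α g a) = (χ g : ℂ) • single α g a := by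
  funext h
  rw [dualAction_apply, smul_apply, single_apply]
  split_ifs with hh
  · rw [hh]
  · rw [smul_zero, smul_zero]

end CrossedProduct

section CrossedProductGenerators

open CrossedProduct

variable {N K : ℕ}

theorem sum_unitaryCoord_mul_star (i j : Fin N) (c : ZMod K) :
    ∑ k, unitaryCoord i k c * star (unitaryCoord j k c) = if i = j then 1 else 0 := by
  ext z
  have h := congrFun (congrFun (Matrix.mem_unitaryGroup_iff.mp (z c).2) i) j
  rw [Matrix.mul_apply, Matrix.one_apply] at h
  rw [ContinuousMap.sum_apply]
  refine h.trans ?_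
  split_ifs <;> rfl

theorem sum_star_unitaryCoord_mul (i j : Fin N) (c : ZMod K) :
    ∑ k, star (unitaryCoord k i c) * unitaryCoord k j c = if i = j then 1 else 0 := by
  ext z
  have h := congrFun (congrFun (Matrix.mem_unitaryGroup_iff'.mp (z c).2) i) j
  rw [Matrix.mul_apply, Matrix.one_apply] at h
  rw [ContinuousMap.sum_apply]
  refine h.trans ?_
  split_ifs <;> rfl

theorem cyclicAction_unitaryCoord (i j : Fin N) (c : ZMod K) (d : Multiplicative (ZMod K)) :
    cyclicAction N K d (unitaryCoord i j c) = unitaryCoord i j (c + d.toAdd) := rfl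

variable (N K) in
/-- The matrix with entries `a i j 0 ⊗ τ` over the crossed product. -/
def crossedMatrix : Matrix (Fin N) (Fin N) (CrossedProduct (cyclicAction N K)) :=
  Matrix.of fun i j => single (cyclicAction N K) (Multiplicative.ofAdd 1) (unitaryCoord i j 0)

theorem crossedMatrix_apply (i j : Fin N) : crossedMatrix N K i j =
    single (cyclicAction N K) (Multiplicative.ofAdd 1) (unitaryCoord i j 0) := rfl

variable [NeZero K]

/-- Each τ moved to the right raises the index of the coordinates it passes by one, so letter s
reads the factor s of U_N^K. -/
theorem matrixWord_crossedMatrix {n : ℕ} (I J : Fin n → Fin N) :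
    matrixWord (crossedMatrix N K) I J = single (cyclicAction N K)
      (Multiplicative.ofAdd (n : ZMod K)) (∏ s : Fin n, unitaryCoord (I s) (J s) ((s : ℕ) : ZMod K))
    := by
  induction n with
  | zero =>
    rw [matrixWord_zero, one_eq_single]
    simp
  | succ n ih =>
    rw [matrixWord_succ, ih, crossedMatrix_apply, single_mul_single, map_prod, Fin.prod_univ_succ,
      ← ofAdd_add]
    simp [cyclicAction_unitaryCoord, Fin.tail, add_comm]

theorem matrixWord_crossedMatrix_self (I J : Fin K → Fin N) :
    matrixWord (crossedMatrix N K) I J = single (cyclicAction N K) 1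
      (∏ s : Fin K, unitaryCoord (I s) (J s) ((s : ℕ) : ZMod K)) := by
  rw [matrixWord_crossedMatrix, ZMod.natCast_self, ofAdd_zero]

/-- Commutativity of functions lets the unitarity of z_0 yield that of the transpose too. Words of
length K commute because τ^K = 1 puts them in C(U_N^K) ⊗ 1. -/
theorem isHalfLiberated_crossedMatrix : IsHalfLiberated K (crossedMatrix N K) where
  mul_conjTranspose := by
    ext1 i j
    rw [Matrix.mul_apply, Matrix.one_apply]
    simp only [Matrix.conjTranspose_apply, crossedMatrix_apply, single_mul_star_single,
      ← single_sum, sum_unitaryCoord_mul_star]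
    split_ifs
    · rfl
    · exact single_zero _ _
  conjTranspose_mul := by
    ext1 i j
    rw [Matrix.mul_apply, Matrix.one_apply]
    simp only [Matrix.conjTranspose_apply, crossedMatrix_apply, star_single_mul_single,
      ← single_sum, ← map_sum, sum_star_unitaryCoord_mul]
    split_ifs
    · rw [map_one]
      rfl
    · rw [map_zero, single_zero]
  transpose_mul := by
    ext1 i j
    rw [Matrix.mul_apply, Matrix.one_apply]
    simp only [Matrix.transpose_apply, Matrix.map_apply, crossedMatrix_apply,
      single_mul_star_single, ← single_sum, mul_comm _ (star _), sum_star_unitaryCoord_mul,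
      eq_comm (a := i)]
    split_ifs
    · rfl
    · exact single_zero _ _
  mul_transpose := by
    ext1 i j
    rw [Matrix.mul_apply, Matrix.one_apply]
    simp only [Matrix.transpose_apply, Matrix.map_apply, crossedMatrix_apply,
      star_single_mul_single, ← single_sum, ← map_sum, mul_comm (star _),
      sum_unitaryCoord_mul_star, eq_comm (a := i)]
    split_ifs
    · rw [map_one]
      rfl
    · rw [map_zero, single_zero]
  commute i j k l := by
    change matrixWord _ i j * matrixWord _ k l = matrixWord _ k l * matrixWord _ i j
    simp only [matrixWord_crossedMatrix_self, single_mul_single, map_one]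
    exact congrArg _ (mul_comm _ _)

end CrossedProductGenerators

namespace IsHalfLiberated

variable {N K : ℕ} {D : Type*} [Ring D] [StarRing D] [Algebra ℂ D] [StarModule ℂ D]
  {v : Matrix (Fin N) (Fin N) D}

theorem _root_.matrixWord_smul {D : Type*} [Ring D] [Algebra ℂ D] (v : Matrix (Fin N) (Fin N) D)
    (c : ℂ) {n : ℕ} (I J : Fin n → Fin N) :
    matrixWord (c • v) I J = c ^ n • matrixWord v I J := by
  induction n with
  | zero => simp
  | succ n ih => rw [matrixWord_succ, matrixWord_succ, ih, Matrix.smul_apply, smul_mul_smul_comm,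
      pow_succ']

theorem smul (h : IsHalfLiberated K v) {c : ℂ} (hc : star c * c = 1) :
    IsHalfLiberated K (c • v) := by
  have hc' : c * star c = 1 := by rw [mul_comm, hc]
  have hs : (c • v).map star = star c • v.map star := by
    ext i j
    exact star_smul c _
  refine ⟨?_, ?_, ?_, ?_, fun i j k l => ?_⟩
  · rw [Matrix.conjTranspose_smul, smul_mul_smul_comm, hc', one_smul, h.mul_conjTranspose]
  · rw [Matrix.conjTranspose_smul, smul_mul_smul_comm, hc, one_smul, h.conjTranspose_mul]
  · rw [Matrix.transpose_smul, hs, smul_mul_smul_comm, hc', one_smul, h.transpose_mul]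
  · rw [Matrix.transpose_smul, hs, smul_mul_smul_comm, hc, one_smul, h.mul_transpose]
  · change Commute (matrixWord (c • v) i j) (matrixWord (c • v) k l)
    rw [matrixWord_smul, matrixWord_smul]
    exact ((h.commute i j k l).smul_left _).smul_right _

end IsHalfLiberated

end

/-! ### The gauge action and its fixed point algebra -/

noncomputable section

open scoped CStarAlgebra

namespace HalfLiberatedUnitary

variable (N K : ℕ)

/-- The matrix of the standard generators of `C(U_{N,K}^*)`. -/
def uMatrix : Matrix (Fin N) (Fin N) (HalfLiberatedUnitary N K) := Matrix.of fun i j => u i j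

variable {N K}

theorem uMatrix_apply (i j : Fin N) : uMatrix N K i j = u i j := rfl

variable (N K) in
theorem isHalfLiberated_uMatrix : IsHalfLiberated K (uMatrix N K) := isHalfLiberated_u N K

/-- The gauge action of the circle, `u i j ↦ c * u i j`. -/
def gauge (c : Circle) : HalfLiberatedUnitary N K →⋆ₐ[ℂ] HalfLiberatedUnitary N K :=
  lift ((c : ℂ) • uMatrix N K) ((isHalfLiberated_uMatrix N K).smul c.star_coe_mul_coe)

theorem gauge_u (c : Circle) (i j : Fin N) :
    gauge c (u i j : HalfLiberatedUnitary N K) = (c : ℂ) • u i j :=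
  lift_u _ _ i j

theorem gauge_one (x : HalfLiberatedUnitary N K) : gauge 1 x = x := by
  have h : gauge 1 = StarAlgHom.id ℂ (HalfLiberatedUnitary N K) :=
    hom_ext fun i j => by rw [gauge_u, Circle.coe_one, one_smul]; rfl
  rw [h]
  rfl

theorem gauge_gauge (c d : Circle) (x : HalfLiberatedUnitary N K) :
    gauge c (gauge d x) = gauge (c * d) x := by
  have h : (gauge c).comp (gauge d) = (gauge (c * d) :
      HalfLiberatedUnitary N K →⋆ₐ[ℂ] HalfLiberatedUnitary N K) :=
    hom_ext fun i j => by
      rw [StarAlgHom.comp_apply, gauge_u, map_smul, gauge_u, gauge_u, smul_smul, Circle.coe_mul,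
        mul_comm]
  rw [← h]
  rfl

theorem gauge_matrixWord (c : Circle) {n : ℕ} (I J : Fin n → Fin N) :
    gauge c (matrixWord (uMatrix N K) I J) = (c : ℂ) ^ n • matrixWord (uMatrix N K) I J := by
  induction n with
  | zero => simp
  | succ n ih =>
    rw [matrixWord_succ, map_mul, ih, uMatrix_apply, gauge_u, smul_mul_smul_comm, pow_succ']

theorem gauge_of_mem_entrySpan_pow (c : Circle) {n : ℕ} {x : HalfLiberatedUnitary N K}
    (hx : x ∈ entrySpan (uMatrix N K) ^ n) : gauge c x = (c : ℂ) ^ n • x := by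
  have hx' := entrySpan_pow_le n hx
  clear hx
  induction hx' using Submodule.span_induction with
  | mem y hy =>
    obtain ⟨⟨I, J⟩, rfl⟩ := hy
    exact gauge_matrixWord c I J
  | zero => rw [map_zero, smul_zero]
  | add y z _ _ hy hz => rw [map_add, hy, hz, smul_add]
  | smul a y _ hy => rw [map_smul, hy, smul_comm]

theorem _root_.ZMod.toCircle_pow_self [NeZero K] (c : ZMod K) :
    ((ZMod.toCircle c : Circle) : ℂ) ^ K = 1 := by
  rw [← Circle.coe_pow, ← AddChar.map_nsmul_eq_pow, nsmul_eq_mul, ZMod.natCast_self, zero_mul,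
    AddChar.map_zero_eq_one, Circle.coe_one]

theorem continuous_gauge (c : Circle) :
    Continuous (gauge c : HalfLiberatedUnitary N K → HalfLiberatedUnitary N K) := by
  have h : Continuous (gauge c : HalfLiberatedUnitary N K →⋆ₐ[ℂ] HalfLiberatedUnitary N K) :=
    map_continuous _
  exact h

variable [NeZero K]

variable (N K) in
/-- The subalgebra of the elements invariant under the gauge action of the `K`-th roots of
unity. -/
def fixedAlgebra : StarSubalgebra ℂ (HalfLiberatedUnitary N K) :=
  ⨅ c : ZMod K, StarAlgHom.equalizer (gauge (ZMod.toCircle c)) (StarAlgHom.id ℂ _)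

theorem mem_fixedAlgebra {x : HalfLiberatedUnitary N K} :
    x ∈ fixedAlgebra N K ↔ ∀ c : ZMod K, gauge (ZMod.toCircle c) x = x := by
  simp only [fixedAlgebra, StarSubalgebra.mem_iInf, StarAlgHom.mem_equalizer]
  rfl

instance isClosed_fixedAlgebra :
    IsClosed (fixedAlgebra N K : Set (HalfLiberatedUnitary N K)) := by
  have h : (fixedAlgebra N K : Set (HalfLiberatedUnitary N K)) =
      ⋂ c : ZMod K, {x | gauge (ZMod.toCircle c) x = x} := by
    ext x
    simp [mem_fixedAlgebra]
  rw [h]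
  exact isClosed_iInter fun c => isClosed_eq (continuous_gauge _) continuous_id

/-- The sum over the orbit of the gauge action of the `K`-th roots of unity. -/
def gaugeSum : HalfLiberatedUnitary N K →ₗ[ℂ] HalfLiberatedUnitary N K :=
  ∑ c : ZMod K, ((gauge (ZMod.toCircle c) :
    HalfLiberatedUnitary N K →⋆ₐ[ℂ] HalfLiberatedUnitary N K) :
    HalfLiberatedUnitary N K →ₐ[ℂ] HalfLiberatedUnitary N K).toLinearMap

theorem gaugeSum_apply (x : HalfLiberatedUnitary N K) :
    gaugeSum x = ∑ c : ZMod K, gauge (ZMod.toCircle c) x := by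
  rw [gaugeSum, LinearMap.sum_apply]
  rfl

theorem continuous_gaugeSum : Continuous (gaugeSum (N := N) (K := K)) := by
  simp only [funext gaugeSum_apply]
  exact continuous_finsetSum _ fun c _ => continuous_gauge _

theorem gaugeSum_mem (x : HalfLiberatedUnitary N K) : gaugeSum x ∈ fixedAlgebra N K := by
  refine mem_fixedAlgebra.mpr fun c => ?_
  rw [gaugeSum_apply, map_sum]
  refine Fintype.sum_equiv (Equiv.addLeft c) _ _ fun d => ?_
  rw [gauge_gauge, ← AddChar.map_add_eq_mul]
  rfl

theorem gaugeSum_of_mem {x : HalfLiberatedUnitary N K} (hx : x ∈ fixedAlgebra N K) :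
    gaugeSum x = (K : ℂ) • x := by
  rw [gaugeSum_apply, Finset.sum_congr rfl fun c _ => mem_fixedAlgebra.mp hx c,
    Finset.sum_const, Finset.card_univ, ZMod.card, ← Nat.cast_smul_eq_nsmul ℂ]

theorem matrixWord_mem_fixedAlgebra (I J : Fin K → Fin N) :
    matrixWord (uMatrix N K) I J ∈ fixedAlgebra N K :=
  mem_fixedAlgebra.mpr fun c => by rw [gauge_matrixWord, ZMod.toCircle_pow_self, one_smul]

theorem wordAlgebra_le_fixedAlgebra : wordAlgebra K (uMatrix N K) ≤ fixedAlgebra N K := by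
  refine StarAlgebra.adjoin_le ?_
  rintro _ ⟨⟨I, J⟩, rfl⟩
  exact matrixWord_mem_fixedAlgebra I J

/-- A term b s, with b in the word algebra and s of degree n, is multiplied by a sum of n-th powers
of roots of unity. That sum vanishes unless K divides n, and then s is already in the word algebra.
-/
theorem gaugeSum_mem_wordAlgebra {x : HalfLiberatedUnitary N K}
    (hx : x ∈ gradedSpan K (uMatrix N K)) : gaugeSum x ∈ wordAlgebra K (uMatrix N K) := by
  suffices h : gradedSpan K (uMatrix N K) ≤ (wordSpace K (uMatrix N K)).comap gaugeSum from h hx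
  refine iSup_le fun n => Submodule.mul_le.mpr fun b hb s hs => ?_
  have h1 (c : ZMod K) : gauge (ZMod.toCircle c) (b * s) =
      ZMod.stdAddChar (c * (n : ZMod K)) • (b * s) := by
    rw [map_mul, mem_fixedAlgebra.mp (wordAlgebra_le_fixedAlgebra hb) c,
      gauge_of_mem_entrySpan_pow _ hs, mul_smul_comm, ← Circle.coe_pow,
      ← AddChar.map_nsmul_eq_pow, nsmul_eq_mul, mul_comm c]
    rfl
  change gaugeSum (b * s) ∈ wordAlgebra K (uMatrix N K)
  rw [gaugeSum_apply, Finset.sum_congr rfl fun c _ => h1 c, ← Finset.sum_smul,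
    AddChar.sum_mulShift _ (ZMod.isPrimitive_stdAddChar K)]
  split_ifs with hn
  · obtain ⟨m, rfl⟩ := (ZMod.natCast_eq_zero_iff n K).mp hn
    exact SMulMemClass.smul_mem _ (mul_mem hb (entrySpan_pow_mul_le_wordSpace m hs))
  · rw [Nat.cast_zero, zero_smul]
    exact zero_mem _

section

variable [NeZero N]

theorem ofFree_mem_gradedSpan (a : FreeStarAlgebra (Fin N × Fin N)) :
    ofFree N K a ∈ gradedSpan K (uMatrix N K) := by
  have h := isHalfLiberated_uMatrix N K
  -- The graded span is only known to be stable under right multiplication by letters, so the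
  -- induction runs over right multipliers.
  suffices h' : ∀ t ∈ gradedSpan K (uMatrix N K), t * ofFree N K a ∈ gradedSpan K (uMatrix N K) by
    simpa using h' 1 one_mem_gradedSpan
  refine ofFree_induction
    (P := fun x => ∀ t ∈ gradedSpan K (uMatrix N K), t * x ∈ gradedSpan K (uMatrix N K))
    ?_ ?_ ?_ ?_ ?_ a
  · intro c t ht
    rw [← Algebra.commutes, ← Algebra.smul_def]
    exact Submodule.smul_mem _ _ ht
  · exact fun i j t ht => gradedSpan_mul_entrySpan_le
      (Submodule.mul_mem_mul ht (entry_mem_entrySpan i j))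
  · exact fun i j t ht => gradedSpan_mul_starEntrySpan_le h.mul_conjTranspose h.conjTranspose_mul
      (Submodule.mul_mem_mul ht (star_entry_mem_starEntrySpan i j))
  · intro a b ha hb t ht
    rw [← mul_assoc]
    exact hb _ (ha _ ht)
  · intro a b ha hb t ht
    rw [mul_add]
    exact add_mem (ha _ ht) (hb _ ht)

/-- A fixed element equals its own gauge average. Approximating it by polynomials and averaging the
approximants lands in the word algebra. -/
theorem fixedAlgebra_le_topologicalClosure :
    fixedAlgebra N K ≤ (wordAlgebra K (uMatrix N K)).topologicalClosure := by
  intro x hx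
  have hK : (K : ℂ) ≠ 0 := Nat.cast_ne_zero.mpr (NeZero.ne K)
  have hx' : x = (K : ℂ)⁻¹ • gaugeSum x := by rw [gaugeSum_of_mem hx, inv_smul_smul₀ hK]
  rw [hx']
  refine SMulMemClass.smul_mem _ ?_
  refine map_mem_closure continuous_gaugeSum
    (s := (gradedSpan K (uMatrix N K) : Set (HalfLiberatedUnitary N K))) ?_
    fun y hy => gaugeSum_mem_wordAlgebra hy
  refine closure_mono ?_ (denseRange_ofFree x)
  rintro _ ⟨a, rfl⟩
  exact ofFree_mem_gradedSpan a

/-- A double centralizer argument: one factor commutes with all words and their adjoints, and the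
other lies in the bicommutant of the words. -/
theorem fixedAlgebra_comm (x : HalfLiberatedUnitary N K) (hx : x ∈ fixedAlgebra N K)
    (y : HalfLiberatedUnitary N K) (hy : y ∈ fixedAlgebra N K) : x * y = y * x := by
  have hs := (isHalfLiberated_uMatrix N K).wordSet_subset_centralizer
  have hle : (wordAlgebra K (uMatrix N K)).topologicalClosure ≤
      StarSubalgebra.centralizer ℂ (wordSet K (uMatrix N K)) :=
    StarSubalgebra.topologicalClosure_minimal
      (StarAlgebra.adjoin_le (Set.subset_union_left.trans hs)) (Set.isClosed_centralizer _)
  have hx' := StarSubalgebra.topologicalClosure_adjoin_le_centralizer_centralizer ℂ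
    (wordSet K (uMatrix N K)) (fixedAlgebra_le_topologicalClosure hx)
  exact ((StarSubalgebra.mem_centralizer_iff ℂ).mp hx' y
    (hle (fixedAlgebra_le_topologicalClosure hy))).1.symm

theorem isNormalized_fixedAlgebra : IsNormalized (fixedAlgebra N K) (uMatrix N K) where
  mul_conjTranspose := (isHalfLiberated_uMatrix N K).mul_conjTranspose
  conjTranspose_mul := (isHalfLiberated_uMatrix N K).conjTranspose_mul
  comm := fixedAlgebra_comm
  conj_mem b hb i j k l := mem_fixedAlgebra.mpr fun c => by
    rw [map_mul, map_mul, mem_fixedAlgebra.mp hb, map_star, uMatrix_apply, uMatrix_apply, gauge_u,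
      gauge_u, star_smul, smul_mul_assoc, smul_mul_smul_comm, mul_comm, Circle.star_coe_mul_coe,
      one_smul]
  star_mul_mem i j k l := mem_fixedAlgebra.mpr fun c => by
    rw [map_mul, map_star, uMatrix_apply, uMatrix_apply, gauge_u, gauge_u, star_smul,
      smul_mul_smul_comm, Circle.star_coe_mul_coe, one_smul]

instance : CommCStarAlgebra (fixedAlgebra N K) where
  __ := StarSubalgebra.cstarAlgebra (fixedAlgebra N K)
  mul_comm x y := Subtype.ext (fixedAlgebra_comm _ x.2 _ y.2)

theorem fixedAlgebra_hom_ext {φ ψ : fixedAlgebra N K →⋆ₐ[ℂ] ℂ}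
    (h : ∀ I J : Fin K → Fin N, φ ⟨_, matrixWord_mem_fixedAlgebra I J⟩ =
      ψ ⟨_, matrixWord_mem_fixedAlgebra I J⟩) : φ = ψ := by
  have hφ : Continuous φ := map_continuous φ
  have hψ : Continuous ψ := map_continuous ψ
  -- The equalizer is pushed into the ambient algebra, where it stays closed because the fixed
  -- algebra is closed. Thus it contains the closure of the word algebra.
  let E : StarSubalgebra ℂ (HalfLiberatedUnitary N K) :=
    (StarAlgHom.equalizer φ ψ).map (fixedAlgebra N K).subtype
  have hE : IsClosed (E : Set (HalfLiberatedUnitary N K)) :=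
    isClosed_fixedAlgebra.isClosedEmbedding_subtypeVal.isClosedMap _ (isClosed_eq hφ hψ)
  have hle : (wordAlgebra K (uMatrix N K)).topologicalClosure ≤ E := by
    refine StarSubalgebra.topologicalClosure_minimal (StarAlgebra.adjoin_le ?_) hE
    rintro _ ⟨⟨I, J⟩, rfl⟩
    exact ⟨⟨_, matrixWord_mem_fixedAlgebra I J⟩, h I J, rfl⟩
  refine StarAlgHom.ext fun b => ?_
  obtain ⟨b', hb', hbb'⟩ := hle (fixedAlgebra_le_topologicalClosure b.2)
  rwa [← Subtype.ext hbb']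

end

end HalfLiberatedUnitary

end

/-! ### Injectivity of the morphism -/

noncomputable section

open scoped CStarAlgebra

namespace HalfLiberatedUnitary

open CrossedProduct

variable {N K : ℕ} [NeZero K]

variable (N K) in
/-- The morphism `u i j ↦ a i j 0 ⊗ τ`. -/
def toCrossedProduct : HalfLiberatedUnitary N K →⋆ₐ[ℂ] CrossedProduct (cyclicAction N K) :=
  lift (crossedMatrix N K) isHalfLiberated_crossedMatrix

theorem toCrossedProduct_u (i j : Fin N) : toCrossedProduct N K (u i j) =
    single (cyclicAction N K) (Multiplicative.ofAdd 1) (unitaryCoord i j 0) :=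
  lift_u _ _ i j

theorem toCrossedProduct_matrixWord {n : ℕ} (I J : Fin n → Fin N) :
    toCrossedProduct N K (matrixWord (uMatrix N K) I J) = matrixWord (crossedMatrix N K) I J := by
  induction n with
  | zero => simp
  | succ n ih =>
    rw [matrixWord_succ, map_mul, ih, uMatrix_apply, toCrossedProduct_u, matrixWord_succ]
    rfl

theorem toCrossedProduct_gauge (c : ZMod K) (x : HalfLiberatedUnitary N K) :
    toCrossedProduct N K (gauge (ZMod.toCircle c) x) =
      dualAction (cyclicAction N K) (ZMod.toCircle.mulShift c).toMonoidHom
        (toCrossedProduct N K x) := by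
  have h : (toCrossedProduct N K).comp (gauge (ZMod.toCircle c)) =
      (dualAction (cyclicAction N K) (ZMod.toCircle.mulShift c).toMonoidHom).comp
        (toCrossedProduct N K) :=
    hom_ext fun i j => by
      rw [StarAlgHom.comp_apply, StarAlgHom.comp_apply, gauge_u, map_smul, toCrossedProduct_u,
        dualAction_single, AddChar.toMonoidHom_apply, toAdd_ofAdd, AddChar.mulShift_apply, mul_one]
  exact DFunLike.congr_fun h x

/-- Gauge invariance turns into invariance under the dual action, which scales the g-coefficient by
the value of a character at g. Only the identity coefficient can survive. -/
theorem toCrossedProduct_of_mem {b : HalfLiberatedUnitary N K} (hb : b ∈ fixedAlgebra N K) :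
    toCrossedProduct N K b = single (cyclicAction N K) 1 (toCrossedProduct N K b 1) := by
  funext g
  rw [single_apply]
  split_ifs with hg
  · rw [hg]
  -- The residue 1 gives a faithful character of ℤ/K, so this single one separates every g ≠ 1 from
  -- the identity.
  have h := congrFun (toCrossedProduct_gauge 1 b) g
  rw [mem_fixedAlgebra.mp hb, dualAction_apply, AddChar.toMonoidHom_apply,
    AddChar.mulShift_apply, one_mul] at h
  have h1 : ((ZMod.toCircle g.toAdd : Circle) : ℂ) ≠ 1 := fun hc => hg (by
    rw [← Circle.coe_one, ← AddChar.map_zero_eq_one (ZMod.toCircle (N := K))] at hc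
    exact ZMod.injective_toCircle (N := K) (Circle.coe_injective hc))
  have h2 : (1 - ((ZMod.toCircle g.toAdd : Circle) : ℂ)) • toCrossedProduct N K b g = 0 := by
    rw [sub_smul, one_smul, ← h, sub_self]
  exact (smul_eq_zero.mp h2).resolve_left (sub_ne_zero.mpr h1.symm)

/-- The character of the fixed point algebra given by a point of `U_N^K`. -/
def evalFixed (z : UnitaryPower N K) : fixedAlgebra N K →⋆ₐ[ℂ] ℂ where
  toFun b := toCrossedProduct N K b 1 z
  map_one' := by
    rw [OneMemClass.coe_one, map_one, one_apply, if_pos rfl]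
    rfl
  map_mul' a b := by
    rw [MulMemClass.coe_mul, map_mul, toCrossedProduct_of_mem a.2, toCrossedProduct_of_mem b.2,
      single_mul_single, map_one, mul_one]
    simp only [single_apply, if_true]
    rfl
  map_zero' := by
    rw [ZeroMemClass.coe_zero, map_zero]
    rfl
  map_add' a b := by
    rw [AddMemClass.coe_add, map_add]
    rfl
  commutes' c := by
    change toCrossedProduct N K (algebraMap ℂ _ c) 1 z = c
    rw [AlgHomClass.commutes, Algebra.algebraMap_eq_smul_one, CrossedProduct.smul_apply, one_apply, if_pos rfl]
    exact mul_one c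
  map_star' b := by
    change toCrossedProduct N K (star (b : HalfLiberatedUnitary N K)) 1 z = _
    rw [map_star, CrossedProduct.star_apply, inv_one, map_one]
    rfl

theorem evalFixed_matrixWord (z : UnitaryPower N K) (I J : Fin K → Fin N) :
    evalFixed z ⟨_, matrixWord_mem_fixedAlgebra I J⟩ =
      ∏ s : Fin K, (z ((s : ℕ) : ZMod K) : Matrix (Fin N) (Fin N) ℂ) (I s) (J s) := by
  change toCrossedProduct N K (matrixWord (uMatrix N K) I J) 1 z = _
  rw [toCrossedProduct_matrixWord, matrixWord_crossedMatrix_self, single_apply, if_pos rfl,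
    ContinuousMap.prod_apply]
  rfl

theorem exists_evalFixed_eq [NeZero N] (χ : fixedAlgebra N K →⋆ₐ[ℂ] ℂ) :
    ∃ z : UnitaryPower N K, χ = evalFixed z := by
  obtain ⟨Z, hZ⟩ := isNormalized_fixedAlgebra.exists_unitaries_of_matrixWord_mem χ K
    matrixWord_mem_fixedAlgebra
  refine ⟨fun c => Z ⟨c.val, c.val_lt⟩, fixedAlgebra_hom_ext fun I J => ?_⟩
  rw [hZ, evalFixed_matrixWord]
  refine Finset.prod_congr rfl fun s _ => ?_
  have hs : (⟨((s : ℕ) : ZMod K).val, ZMod.val_lt _⟩ : Fin K) = s :=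
    Fin.ext (ZMod.val_cast_of_lt s.2)
  rw [hs]

open WeakDual in
theorem eq_zero_of_mem_fixedAlgebra [NeZero N] {b : HalfLiberatedUnitary N K}
    (hb : b ∈ fixedAlgebra N K) (h : toCrossedProduct N K b = 0) : b = 0 := by
  suffices h' : (⟨b, hb⟩ : fixedAlgebra N K) = 0 from congrArg Subtype.val h'
  refine (gelfandTransform_isometry (fixedAlgebra N K)).injective ?_
  rw [map_zero]
  ext φ
  obtain ⟨z, hz⟩ := exists_evalFixed_eq
    { CharacterSpace.toAlgHom φ with map_star' := fun a => map_star φ a }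
  refine (DFunLike.congr_fun hz (⟨b, hb⟩ : fixedAlgebra N K)).trans ?_
  change toCrossedProduct N K b 1 z = 0
  rw [h]
  rfl

theorem toCrossedProduct_injective_of_neZero [NeZero N] :
    Function.Injective (toCrossedProduct N K) := by
  refine (injective_iff_map_eq_zero _).mpr fun x hx => ?_
  let : PartialOrder (HalfLiberatedUnitary N K) := CStarAlgebra.spectralOrder _
  have : StarOrderedRing (HalfLiberatedUnitary N K) := CStarAlgebra.spectralOrderedRing _
  -- The kernel is gauge invariant, so it contains this sum of positive elements. Each term then
  -- vanishes, and the term of c = 0 is x⋆x.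
  have h0 : gaugeSum (star x * x) = (0 : HalfLiberatedUnitary N K) := by
    refine eq_zero_of_mem_fixedAlgebra (gaugeSum_mem _) ?_
    rw [gaugeSum_apply, map_sum]
    refine Finset.sum_eq_zero fun c _ => ?_
    rw [toCrossedProduct_gauge, map_mul, hx, mul_zero, map_zero]
  rw [gaugeSum_apply, Finset.sum_eq_zero_iff_of_nonneg fun c _ => by
    rw [map_mul, map_star]
    exact star_mul_self_nonneg _] at h0
  have h1 := h0 0 (Finset.mem_univ _)
  rwa [AddChar.map_zero_eq_one, gauge_one, CStarRing.star_mul_self_eq_zero_iff] at h1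

theorem _root_.CrossedProduct.nontrivial {A G : Type*} [CStarAlgebra A] [Nontrivial A] [Group G]
    [DecidableEq G] [Fintype G] (α : G →* (A ≃⋆ₐ[ℂ] A)) : Nontrivial (CrossedProduct α) :=
  ⟨1, 0, fun h => one_ne_zero (α := A) ((if_pos rfl).symm.trans (congrFun h 1))⟩

/-- For `N = 0` the source consists of scalars. -/
theorem toCrossedProduct_injective_zero : Function.Injective (toCrossedProduct 0 K) := by
  have hC : Nontrivial (CrossedProduct (cyclicAction 0 K)) := CrossedProduct.nontrivial _
  have hA : Nontrivial (HalfLiberatedUnitary 0 K) :=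
    RingHom.domain_nontrivial
      (toCrossedProduct 0 K : HalfLiberatedUnitary 0 K →+* CrossedProduct (cyclicAction 0 K))
  have hscalar (a : FreeStarAlgebra (Fin 0 × Fin 0)) :
      ∃ c : ℂ, ofFree 0 K a = algebraMap ℂ _ c := by
    refine ofFree_induction (P := fun x => ∃ c : ℂ, x = algebraMap ℂ _ c) (fun c => ⟨c, rfl⟩)
      (fun i => i.elim0) (fun i => i.elim0) ?_ ?_ a
    · rintro _ _ ⟨c, rfl⟩ ⟨d, rfl⟩
      exact ⟨c * d, (map_mul _ _ _).symm⟩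
    · rintro _ _ ⟨c, rfl⟩ ⟨d, rfl⟩
      exact ⟨c + d, (map_add _ _ _).symm⟩
  have hcont : Continuous (toCrossedProduct 0 K) := map_continuous _
  -- Both algebras are nontrivial, so a scalar has the same norm in each; density extends this to
  -- the completion.
  have hnorm (x : HalfLiberatedUnitary 0 K) : ‖toCrossedProduct 0 K x‖ = ‖x‖ :=
    denseRange_ofFree.induction_on (p := fun x => ‖toCrossedProduct 0 K x‖ = ‖x‖) x
      (isClosed_eq hcont.norm continuous_norm) fun a => by
        obtain ⟨c, hc⟩ := hscalar a
        rw [hc, AlgHomClass.commutes, norm_algebraMap', norm_algebraMap']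
  exact (AddMonoidHomClass.isometry_of_norm (toCrossedProduct 0 K) hnorm).injective

theorem toCrossedProduct_injective : Function.Injective (toCrossedProduct N K) := by
  obtain rfl | hN := N.eq_zero_or_pos
  · exact toCrossedProduct_injective_zero
  · have : NeZero N := ⟨hN.ne'⟩
    exact toCrossedProduct_injective_of_neZero

end HalfLiberatedUnitary

end

theorem theorem7p3 (N K : ℕ) [NeZero K] :
    ∃ π : HalfLiberatedUnitary N K →⋆ₐ[ℂ] CrossedProduct (cyclicAction N K),
      Function.Injective π ∧
      ∀ i j : Fin N, π (HalfLiberatedUnitary.u i j) =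
        CrossedProduct.single (cyclicAction N K) (Multiplicative.ofAdd 1) (unitaryCoord i j 0) := 
  ⟨HalfLiberatedUnitary.toCrossedProduct N K, HalfLiberatedUnitary.toCrossedProduct_injective,
    HalfLiberatedUnitary.toCrossedProduct_u⟩
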